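/- Let $a>0$, $\mu_s>0$, $\omega\in\mathbb R\setminus\{0\}$, $1<q<\infty$ and $1/q+1/q'=1$. Let $\mathsf M=\{x\in\mathbb R^3:|x|=a\}$ carry the metric $g$ induced by $\mathbb R^3$, with Levi-Civita connection $\nabla$ and area measure $\mu_g$; let $\theta$ denote the longitude and $\phi$ the colatitude, and write $(u|v)_{\mathsf M}=\int_{\mathsf M}(u|v)_g\,d\mu_g$ (also for $(1,1)$-tensor fields). Let $\mathbb P_H u=u-\operatorname{grad}\psi_u$ be the Helmholtz projection on $L_q(\mathsf M;T\mathsf M)$, where $\operatorname{grad}\psi_u\in L_q(\mathsf M;T\mathsf M)$ is the unique solution of $(\operatorname{grad}\psi_u|\operatorname{grad}\varphi)_{\mathsf M}=(u|\operatorname{grad}\varphi)_{\mathsf M}$ for all $\varphi\in \dot H^1_{q'}(\mathsf M)$. Put $L_{q,\sigma}=\mathbb P_H L_q(\mathsf M;T\mathsf M)$, $H^1_{q,\sigma}=H^1_q(\mathsf M;T\mathsf M)\cap L_{q,\sigma}$ and $H^{-1}_{q,\sigma}=(H^1_{q',\sigma})'$. Let $D_u=\tfrac12(\nabla u+(\nabla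 u)^{\mathsf T})$, and let $Cu=-2\omega\cos\phi\,Ku$, where $K$ rotates tangent vectors by $90^\circ$ counterclockwise about the outward normal. Define $A^{\mathsf w},B^{\mathsf w}:H^1_{q,\sigma}\to H^{-1}_{q,\sigma}$ by $$\langle A^{\mathsf w}u,v\rangle=2\mu_s(D_u|D_v)_{\mathsf M},\qquad \langle B^{\mathsf w}u,v\rangle=(\mathbb P_H Cu|v)_{\mathsf M},\qquad u\in H^1_{q,\sigma},\ v\in H^1_{q',\sigma}.$$ Then $$\{u\in H^1_{q,\sigma}: A^{\mathsf w}u+B^{\mathsf w}u=0\}=\Big\{c\,\frac{\partial}{\partial\theta}: c\in\mathbb R\Big\},$$ where $\partial/\partial\theta$ is the field $(x,y,z)\mapsto(-y,x,0)$; that is, the elements of the kernel are exactly the rotations about the $z$-axis. -/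

import Mathlib

open MeasureTheory Metric Set
open scoped ENNReal RealInnerProductSpace

noncomputable section

namespace SphereFlow

/-- The ambient Euclidean space `ℝ³`. -/
abbrev E3 : Type := EuclideanSpace ℝ (Fin 3)

/-- Real `3 × 3` matrices with the inner product `(S | T) = ∑ S_ij T_ij = tr(Sᵀ T)`. A
`(1,1)`-tensor on a tangent plane of the sphere is identified with the matrix of the endomorphism of
`ℝ³` that extends it by zero on the normal line; this preserves inner products and transposes. -/
abbrev T3 : Type := EuclideanSpace ℝ (Fin 3 × Fin 3)

/-- The matrix of an endomorphism of `ℝ³` in the standard basis. -/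
def toTensor (S : E3 →L[ℝ] E3) : T3 :=
  WithLp.toLp 2 fun ij => S (EuclideanSpace.single ij.2 (1 : ℝ)) ij.1

/-! ### The round sphere of radius `a` -/

/-- The area measure `μ_g` of the sphere of radius `a` centred at the origin, as a measure on `ℝ³`
that is carried by the sphere: the image under `x ↦ a x` of the area measure of the unit sphere,
multiplied by `a ^ 2`. -/
def area (a : ℝ) : Measure E3 :=
  ENNReal.ofReal (a ^ 2) •
    (volume : Measure E3).toSphere.map (fun x : sphere (0 : E3) 1 => a • (x : E3))

instance area_isFiniteMeasure (a : ℝ) : IsFiniteMeasure (area a) := by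
  unfold area
  exact Measure.smul_finite _ ENNReal.ofReal_ne_top

theorem ae_mem_sphere {a : ℝ} : ∀ᵐ x ∂(area a), x ∈ sphere (0 : E3) |a| := by
  unfold area
  refine Measure.ae_smul_measure ?_ _
  refine (ae_map_iff (p := fun x : E3 => x ∈ sphere (0 : E3) |a|) (by fun_prop)
    isClosed_sphere.measurableSet).2 ?_
  refine Filter.Eventually.of_forall fun x => ?_
  have hx : ‖(x : E3)‖ = 1 := by simp
  simp [norm_smul, hx]

theorem memLp_of_continuous {F : Type*} [NormedAddCommGroup F] (a : ℝ) (q : ℝ≥0∞)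
    {f : E3 → F} (hf : Continuous f) [SecondCountableTopologyEither E3 F] :
    MemLp f q (area a) := by
  obtain ⟨C, hC⟩ := (isCompact_sphere (0 : E3) |a|).exists_bound_of_continuousOn hf.continuousOn
  refine MemLp.of_bound hf.aestronglyMeasurable C ?_
  filter_upwards [ae_mem_sphere] with x hx using hC x hx

/-- The orthogonal projection of `ℝ³` onto the plane tangent to the sphere of radius `a` at the
point `x` of this sphere. -/
def tangentProj (a : ℝ) (x : E3) : E3 →L[ℝ] E3 :=
  ContinuousLinearMap.id ℝ E3 - (a ^ 2)⁻¹ • (innerSL ℝ x).smulRight x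

/-- The vector product in `ℝ³`. -/
def cross (x v : E3) : E3 := WithLp.toLp 2 (crossProduct (WithLp.ofLp x) (WithLp.ofLp v))

/-! ### Smooth tangential fields, covariant derivative, gradient -/

/-- Smooth tangential vector fields on the sphere of radius `a`, given as restrictions of smooth
maps of `ℝ³`. -/
structure IsSmoothField (a : ℝ) (U : E3 → E3) : Prop where
  smooth : ContDiff ℝ ((⊤ : ℕ∞) : WithTop ℕ∞) U
  tangent : ∀ x ∈ sphere (0 : E3) a, ⟪x, U x⟫ = 0

/-- The covariant derivative `∇U` (Levi-Civita connection of the sphere): for tangent `ξ`,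
`∇_ξ U` is the tangential part of the directional derivative of `U` along `ξ`. -/
def covDeriv (a : ℝ) (U : E3 → E3) (x : E3) : T3 :=
  toTensor (tangentProj a x ∘L fderiv ℝ U x ∘L tangentProj a x)

/-- The surface gradient of (the restriction to the sphere of) a function. -/
def surfaceGrad (a : ℝ) (Φ : E3 → ℝ) (x : E3) : E3 := tangentProj a x (gradient Φ x)

theorem continuous_tangentProj (a : ℝ) : Continuous (tangentProj a) := by
  unfold tangentProj
  have h : Continuous (fun x : E3 => (innerSL ℝ x).smulRight x) :=
    ((ContinuousLinearMap.smulRightL ℝ E3 E3).continuous₂).comp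
      ((innerSL ℝ).continuous.prodMk continuous_id)
  exact continuous_const.sub (h.const_smul ((a ^ 2)⁻¹))

theorem continuous_covDeriv (a : ℝ) {U : E3 → E3}
    (hU : ContDiff ℝ ((⊤ : ℕ∞) : WithTop ℕ∞) U) : Continuous (covDeriv a U) := by
  have h : Continuous fun x => tangentProj a x ∘L fderiv ℝ U x ∘L tangentProj a x :=
    (continuous_tangentProj a).clm_comp
    ((hU.continuous_fderiv (by simp)).clm_comp (continuous_tangentProj a))
  refine (PiLp.continuous_toLp 2 _).comp (continuous_pi fun ij => ?_)
  exact (EuclideanSpace.proj (𝕜 := ℝ) ij.1).continuous.comp (h.clm_apply continuous_const)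

theorem covDeriv_add (a : ℝ) {U V : E3 → E3} (hU : ContDiff ℝ ((⊤ : ℕ∞) : WithTop ℕ∞) U)
    (hV : ContDiff ℝ ((⊤ : ℕ∞) : WithTop ℕ∞) V) (x : E3) :
    covDeriv a (U + V) x = covDeriv a U x + covDeriv a V x := by
  have h : fderiv ℝ (U + V) x = fderiv ℝ U x + fderiv ℝ V x :=
    fderiv_add (hU.differentiable (by simp) x) (hV.differentiable (by simp) x)
  ext ij
  simp [covDeriv, toTensor, h]

theorem covDeriv_smul (a c : ℝ) {U : E3 → E3} (hU : ContDiff ℝ ((⊤ : ℕ∞) : WithTop ℕ∞) U)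
    (x : E3) : covDeriv a (c • U) x = c • covDeriv a U x := by
  have h : fderiv ℝ (c • U) x = c • fderiv ℝ U x :=
    fderiv_const_smul (hU.differentiable (by simp) x) c
  ext ij
  simp [covDeriv, toTensor, h]

theorem surfaceGrad_add (a : ℝ) {Φ Ψ : E3 → ℝ} (hΦ : ContDiff ℝ ((⊤ : ℕ∞) : WithTop ℕ∞) Φ)
    (hΨ : ContDiff ℝ ((⊤ : ℕ∞) : WithTop ℕ∞) Ψ) (x : E3) :
    surfaceGrad a (Φ + Ψ) x = surfaceGrad a Φ x + surfaceGrad a Ψ x := by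
  have h : fderiv ℝ (Φ + Ψ) x = fderiv ℝ Φ x + fderiv ℝ Ψ x :=
    fderiv_add (hΦ.differentiable (by simp) x) (hΨ.differentiable (by simp) x)
  simp [surfaceGrad, gradient, h]

theorem surfaceGrad_smul (a c : ℝ) {Φ : E3 → ℝ} (hΦ : ContDiff ℝ ((⊤ : ℕ∞) : WithTop ℕ∞) Φ)
    (x : E3) : surfaceGrad a (c • Φ) x = c • surfaceGrad a Φ x := by
  have h : fderiv ℝ (c • Φ) x = c • fderiv ℝ Φ x :=
    fderiv_const_smul (hΦ.differentiable (by simp) x) c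
  simp [surfaceGrad, gradient, h]

/-! ### Lebesgue and Sobolev spaces -/

/-- `L_q(M; TM)`: the `L_q` fields that are tangential almost everywhere. -/
def LqTangent (a : ℝ) (q : ℝ≥0∞) : Submodule ℝ (Lp E3 q (area a)) where
  carrier := {u | ∀ᵐ x ∂(area a), ⟪x, u x⟫ = 0}
  zero_mem' := by
    change ∀ᵐ x ∂(area a), ⟪x, (0 : Lp E3 q (area a)) x⟫ = 0
    filter_upwards [Lp.coeFn_zero E3 q (area a)] with x hx
    rw [hx]
    simp
  add_mem' := by
    intro u v hu hv
    change ∀ᵐ x ∂(area a), ⟪x, (u + v) x⟫ = 0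
    filter_upwards [Lp.coeFn_add u v, hu, hv] with x hx h1 h2
    rw [hx, Pi.add_apply, inner_add_right, h1, h2, add_zero]
  smul_mem' := by
    intro c u hu
    change ∀ᵐ x ∂(area a), ⟪x, (c • u) x⟫ = 0
    filter_upwards [Lp.coeFn_smul c u, hu] with x hx h1
    rw [hx, Pi.smul_apply, inner_smul_right, h1, mul_zero]

/-- The pairs `(U, ∇U)` with `U` a smooth tangential field. -/
def smoothFieldPairs (a : ℝ) (q : ℝ≥0∞) :
    Submodule ℝ (Lp E3 q (area a) × Lp T3 q (area a)) where
  carrier := {p | ∃ U : E3 → E3, IsSmoothField a U ∧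
    p.1 =ᵐ[area a] U ∧ p.2 =ᵐ[area a] covDeriv a U}
  zero_mem' := by
    refine ⟨0, ⟨contDiff_const, by simp⟩, Lp.coeFn_zero E3 q (area a), ?_⟩
    filter_upwards [Lp.coeFn_zero T3 q (area a)] with x hx
    refine hx.trans ?_
    ext ij
    simp [covDeriv, toTensor]
  add_mem' := by
    rintro p r ⟨U, hU, h1, h2⟩ ⟨V, hV, k1, k2⟩
    refine ⟨U + V, ⟨hU.smooth.add hV.smooth, fun x hx => ?_⟩, ?_, ?_⟩
    · simp [inner_add_right, hU.tangent x hx, hV.tangent x hx]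
    · filter_upwards [Lp.coeFn_add p.1 r.1, h1, k1] with x hx h k
      rw [Prod.fst_add, hx, Pi.add_apply, h, k, Pi.add_apply]
    · filter_upwards [Lp.coeFn_add p.2 r.2, h2, k2] with x hx h k
      rw [Prod.snd_add, hx, Pi.add_apply, h, k, covDeriv_add a hU.smooth hV.smooth]
  smul_mem' := by
    rintro c p ⟨U, hU, h1, h2⟩
    refine ⟨c • U, ⟨contDiff_const.smul hU.smooth, fun x hx => ?_⟩, ?_, ?_⟩
    · simp [inner_smul_right, hU.tangent x hx]
    · filter_upwards [Lp.coeFn_smul c p.1, h1] with x hx h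
      simp [hx, h]
    · filter_upwards [Lp.coeFn_smul c p.2, h2] with x hx h
      simp [hx, h, covDeriv_smul a c hU.smooth]

/-- The Sobolev space `H¹_q(M; TM)`: the completion of the smooth tangential fields in the norm of
`‖u‖_{L_q} + ‖∇u‖_{L_q}`. An element is the pair `(u, ∇u)` of a field and its covariant
derivative. -/
def H1 (a : ℝ) (q : ℝ≥0∞) [Fact (1 ≤ q)] :
    Submodule ℝ (Lp E3 q (area a) × Lp T3 q (area a)) :=
  (smoothFieldPairs a q).topologicalClosure

/-- The pairs `(Φ, grad Φ)` with `Φ` a smooth function. -/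
def smoothScalarPairs (a : ℝ) (q : ℝ≥0∞) :
    Submodule ℝ (Lp ℝ q (area a) × Lp E3 q (area a)) where
  carrier := {p | ∃ Φ : E3 → ℝ, ContDiff ℝ ((⊤ : ℕ∞) : WithTop ℕ∞) Φ ∧
    p.1 =ᵐ[area a] Φ ∧ p.2 =ᵐ[area a] surfaceGrad a Φ}
  zero_mem' := by
    refine ⟨0, contDiff_const, Lp.coeFn_zero ℝ q (area a), ?_⟩
    filter_upwards [Lp.coeFn_zero E3 q (area a)] with x hx
    simpa [surfaceGrad, gradient] using hx
  add_mem' := by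
    rintro p r ⟨U, hU, h1, h2⟩ ⟨V, hV, k1, k2⟩
    refine ⟨U + V, hU.add hV, ?_, ?_⟩
    · filter_upwards [Lp.coeFn_add p.1 r.1, h1, k1] with x hx h k
      rw [Prod.fst_add, hx, Pi.add_apply, h, k, Pi.add_apply]
    · filter_upwards [Lp.coeFn_add p.2 r.2, h2, k2] with x hx h k
      rw [Prod.snd_add, hx, Pi.add_apply, h, k, surfaceGrad_add a hU hV]
  smul_mem' := by
    rintro c p ⟨U, hU, h1, h2⟩
    refine ⟨c • U, contDiff_const.smul hU, ?_, ?_⟩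
    · filter_upwards [Lp.coeFn_smul c p.1, h1] with x hx h
      simp [hx, h]
    · filter_upwards [Lp.coeFn_smul c p.2, h2] with x hx h
      simp [hx, h, surfaceGrad_smul a c hU]

/-- The scalar Sobolev space `H¹_q(M)`, with elements the pairs `(φ, grad φ)`. On the compact
sphere the homogeneous space consists of the same functions, taken modulo constants. -/
def H1Scalar (a : ℝ) (q : ℝ≥0∞) [Fact (1 ≤ q)] :
    Submodule ℝ (Lp ℝ q (area a) × Lp E3 q (area a)) :=
  (smoothScalarPairs a q).topologicalClosure

/-! ### Duality pairings -/

/-- `(u | v)_M = ∫_M (u | v)_g dμ_g` on `L_q × L_{q'}`, for vector fields. -/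
def fieldPairing (a : ℝ) (q q' : ℝ≥0∞) [Fact (1 ≤ q)] [Fact (1 ≤ q')] [q.HolderConjugate q'] :
    Lp E3 q (area a) →L[ℝ] Lp E3 q' (area a) →L[ℝ] ℝ :=
  (innerSL ℝ).lpPairing (area a) q q'

/-- `(S | T)_M = ∫_M (S | T)_g dμ_g` on `L_q × L_{q'}`, for tensor fields. -/
def tensorPairing (a : ℝ) (q q' : ℝ≥0∞) [Fact (1 ≤ q)] [Fact (1 ≤ q')] [q.HolderConjugate q'] :
    Lp T3 q (area a) →L[ℝ] Lp T3 q' (area a) →L[ℝ] ℝ :=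
  (innerSL ℝ).lpPairing (area a) q q'

/-! ### Helmholtz projection and solenoidal fields -/

/-- The graph of the Helmholtz projection on `L_q(M; TM)`: the pairs `(u, u - grad ψ)` with
`ψ ∈ H¹_q` and `(grad ψ | grad φ)_M = (u | grad φ)_M` for all `φ ∈ H¹_{q'}`. -/
def helmholtzGraph (a : ℝ) (q q' : ℝ≥0∞) [Fact (1 ≤ q)] [Fact (1 ≤ q')] [q.HolderConjugate q'] :
    Submodule ℝ (Lp E3 q (area a) × Lp E3 q (area a)) where
  carrier := {p | p.1 ∈ LqTangent a q ∧ ∃ ψ ∈ H1Scalar a q, p.2 = p.1 - ψ.2 ∧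
    ∀ φ ∈ H1Scalar a q', fieldPairing a q q' ψ.2 φ.2 = fieldPairing a q q' p.1 φ.2}
  zero_mem' := ⟨Submodule.zero_mem _, 0, Submodule.zero_mem _, by simp, by simp⟩
  add_mem' := by
    rintro p r ⟨hp, ψ, hψ, h1, h2⟩ ⟨hr, χ, hχ, k1, k2⟩
    refine ⟨Submodule.add_mem _ hp hr, ψ + χ, Submodule.add_mem _ hψ hχ, ?_, fun φ hφ => ?_⟩
    · simp only [Prod.snd_add, Prod.fst_add, h1, k1]
      abel
    · simp only [Prod.snd_add, Prod.fst_add, map_add, add_apply, h2 φ hφ,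
        k2 φ hφ]
  smul_mem' := by
    rintro c p ⟨hp, ψ, hψ, h1, h2⟩
    refine ⟨Submodule.smul_mem _ c hp, c • ψ, Submodule.smul_mem _ c hψ, ?_, fun φ hφ => ?_⟩
    · simp only [Prod.smul_snd, Prod.smul_fst, h1, smul_sub]
    · simp only [Prod.smul_snd, Prod.smul_fst, map_smul, smul_apply, h2 φ hφ]

open Classical in
/-- The Helmholtz projection `P_H u = u - grad ψ_u` on `L_q(M; TM)`. -/
def helmholtzProj (a : ℝ) (q q' : ℝ≥0∞) [Fact (1 ≤ q)] [Fact (1 ≤ q')] [q.HolderConjugate q']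
    (u : Lp E3 q (area a)) : Lp E3 q (area a) :=
  if h : ∃ w, (u, w) ∈ helmholtzGraph a q q' then h.choose else 0

/-- `L_{q,σ}(M; TM) = P_H L_q(M; TM)`, the range of the Helmholtz projection. -/
def LqSol (a : ℝ) (q q' : ℝ≥0∞) [Fact (1 ≤ q)] [Fact (1 ≤ q')] [q.HolderConjugate q'] :
    Submodule ℝ (Lp E3 q (area a)) :=
  (helmholtzGraph a q q').map (LinearMap.snd ℝ _ _)

/-- `H¹_{q,σ}(M; TM) = H¹_q(M; TM) ∩ L_{q,σ}(M; TM)`. -/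
def H1Sol (a : ℝ) (q q' : ℝ≥0∞) [Fact (1 ≤ q)] [Fact (1 ≤ q')] [q.HolderConjugate q'] :
    Submodule ℝ (Lp E3 q (area a) × Lp T3 q (area a)) :=
  H1 a q ⊓ (LqSol a q q').comap (LinearMap.fst ℝ _ _)

/-- `H⁻¹_{q,σ}(M; TM)`, the dual space of `H¹_{q',σ}(M; TM)`. -/
abbrev HNeg1Sol (a : ℝ) (q q' : ℝ≥0∞) [Fact (1 ≤ q)] [Fact (1 ≤ q')] [q.HolderConjugate q'] :
    Type :=
  H1Sol a q' q →L[ℝ] ℝ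

/-! ### The weak Stokes operator -/

/-- The symmetric part `(S + Sᵀ) / 2` of a tensor. -/
def symPart : T3 →L[ℝ] T3 :=
  LinearMap.toContinuousLinearMap
    { toFun := fun S => WithLp.toLp 2 fun ij => (S (ij.1, ij.2) + S (ij.2, ij.1)) / 2
      map_add' := fun S T => by
        ext ij
        simp
        ring
      map_smul' := fun c S => by
        ext ij
        simp
        ring }

/-- The deformation tensor `D_u = (∇u + (∇u)ᵀ) / 2` of `u ∈ H¹_{q,σ}(M; TM)`. -/
def deformation (a : ℝ) (q q' : ℝ≥0∞) [Fact (1 ≤ q)] [Fact (1 ≤ q')] [q.HolderConjugate q'] :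
    H1Sol a q q' →L[ℝ] Lp T3 q (area a) :=
  symPart.compLpL q (area a) ∘L ContinuousLinearMap.snd ℝ _ _ ∘L (H1Sol a q q').subtypeL

/-- The weak Stokes operator `A^w : H¹_{q,σ}(M; TM) → H⁻¹_{q,σ}(M; TM)`,
`⟨A^w u, v⟩ = 2 μ_s (D_u | D_v)_M`. -/
def weakStokes (a μs : ℝ) (q q' : ℝ≥0∞) [Fact (1 ≤ q)] [Fact (1 ≤ q')] [q.HolderConjugate q'] : H1Sol a q q' →L[ℝ] HNeg1Sol a q q' :=
  (2 * μs) • (tensorPairing a q q').bilinearComp (deformation a q q') (deformation a q' q)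

/-! ### The Coriolis term -/

/-- The rotation operator `K` at the point `x` of the sphere of radius `a`: counterclockwise
rotation of tangent vectors by a right angle, about the outward normal `x / a`. -/
def rotK (a : ℝ) (x v : E3) : E3 := cross (a⁻¹ • x) v

/-- The Coriolis term `C v = -2 ω cos φ K v` at the point `x`, where the cosine of the colatitude
is `cos φ = x₃ / a`. -/
def coriolisAt (a ω : ℝ) (x v : E3) : E3 := (-2 * ω * (x 2 / a)) • rotK a x v

theorem continuous_coriolisAt (a ω : ℝ) :
    Continuous (fun p : E3 × E3 => coriolisAt a ω p.1 p.2) := by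
  unfold coriolisAt rotK cross
  have h0 : Continuous (fun p : E3 × E3 => -2 * ω * (p.1 2 / a)) := by fun_prop
  refine h0.smul ?_
  refine (PiLp.continuous_toLp 2 _).comp ?_
  refine continuous_pi fun i => ?_
  fin_cases i <;> simp [cross_apply] <;> fun_prop

theorem norm_cross_le (x v : E3) : ‖cross x v‖ ≤ ‖x‖ * ‖v‖ := by
  refine le_of_sq_le_sq ?_ (by positivity)
  rw [mul_pow, EuclideanSpace.norm_sq_eq, EuclideanSpace.norm_sq_eq, EuclideanSpace.norm_sq_eq]
  simp only [Fin.sum_univ_three, cross, cross_apply, Real.norm_eq_abs, sq_abs]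
  simp
  nlinarith [sq_nonneg (x 0 * v 0 + x 1 * v 1 + x 2 * v 2)]

theorem norm_coriolisAt_le (a ω : ℝ) (x v : E3) :
    ‖coriolisAt a ω x v‖ ≤ |(-2 * ω * (x 2 / a))| * (‖a⁻¹ • x‖ * ‖v‖) := by
  unfold coriolisAt rotK
  rw [norm_smul, Real.norm_eq_abs]
  gcongr
  exact norm_cross_le _ _

theorem memLp_coriolis (a ω : ℝ) (q : ℝ≥0∞) (u : Lp E3 q (area a)) :
    MemLp (fun x => coriolisAt a ω x (u x)) q (area a) := by
  obtain ⟨C, hC⟩ := (isCompact_sphere (0 : E3) |a|).exists_bound_of_continuousOn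
    (f := fun x : E3 => |(-2 * ω * (x 2 / a))| * ‖a⁻¹ • x‖) (by fun_prop)
  refine MemLp.of_le_mul (c := C) (Lp.memLp u) ?_ ?_
  · exact (continuous_coriolisAt a ω).comp_aestronglyMeasurable
      (continuous_id.aestronglyMeasurable.prodMk (Lp.aestronglyMeasurable u))
  · filter_upwards [ae_mem_sphere] with x hx
    refine (norm_coriolisAt_le a ω x (u x)).trans ?_
    rw [← mul_assoc]
    gcongr
    exact (le_abs_self _).trans (hC x hx)

/-- The Coriolis operator `C` on `L_q` fields. -/
def coriolis (a ω : ℝ) (q : ℝ≥0∞) (u : Lp E3 q (area a)) : Lp E3 q (area a) :=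
  (memLp_coriolis a ω q u).toLp _

/-- The weak Coriolis operator `B^w : H¹_{q,σ}(M; TM) → H⁻¹_{q,σ}(M; TM)`,
`⟨B^w u, φ⟩ = (P_H C u | φ)_M`. -/
def weakCoriolis (a ω : ℝ) (q q' : ℝ≥0∞) [Fact (1 ≤ q)] [Fact (1 ≤ q')] [q.HolderConjugate q']
    (u : H1Sol a q q') : HNeg1Sol a q q' :=
  fieldPairing a q q' (helmholtzProj a q q' (coriolis a ω q u.1.1)) ∘L
    ContinuousLinearMap.fst ℝ _ _ ∘L (H1Sol a q' q).subtypeL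

/-- The null space `N(A^w + B^w)`, as a subset of the space of pairs `(u, ∇u)`. -/
def weakKernel (a μs ω : ℝ) (q q' : ℝ≥0∞) [Fact (1 ≤ q)] [Fact (1 ≤ q')]
    [q.HolderConjugate q'] :
    Set (Lp E3 q (area a) × Lp T3 q (area a)) :=
  Subtype.val '' {u : H1Sol a q q' | weakStokes a μs q q' u + weakCoriolis a ω q q' u = 0}

/-! ### Rotations about the `z`-axis -/

/-- The point of the sphere of radius `a` with longitude `θ` and colatitude `φ`. -/
def sphericalPoint (a θ φ : ℝ) : E3 :=
  !₂[a * Real.sin φ * Real.cos θ, a * Real.sin φ * Real.sin θ, a * Real.cos φ]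

/-- The coordinate field `∂/∂θ`, extended smoothly over the poles: at `(x, y, z)` it is
`(-y, x, 0)`. -/
def dTheta (x : E3) : E3 := !₂[-(x 1), x 0, 0]

/-- `dTheta` is the derivative of the spherical coordinates with respect to the longitude. -/
theorem hasDerivAt_sphericalPoint (a θ φ : ℝ) :
    HasDerivAt (fun t => sphericalPoint a t φ) (dTheta (sphericalPoint a θ φ)) θ := by
  have h : HasDerivAt (fun t : ℝ => (![a * Real.sin φ * Real.cos t, a * Real.sin φ * Real.sin t,
      a * Real.cos φ] : Fin 3 → ℝ))
      ![-(a * Real.sin φ * Real.sin θ), a * Real.sin φ * Real.cos θ, 0] θ := by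
    refine hasDerivAt_pi.2 fun i => ?_
    fin_cases i
    · simpa using (Real.hasDerivAt_cos θ).const_mul (a * Real.sin φ)
    · simpa using (Real.hasDerivAt_sin θ).const_mul (a * Real.sin φ)
    · simpa using hasDerivAt_const θ (a * Real.cos φ)
  exact ((PiLp.continuousLinearEquiv 2 ℝ (fun _ : Fin 3 => ℝ)).symm.hasFDerivAt).comp_hasDerivAt θ h

theorem contDiff_dTheta : ContDiff ℝ ((⊤ : ℕ∞) : WithTop ℕ∞) dTheta := by
  rw [contDiff_euclidean]
  intro i
  fin_cases i <;> simp [dTheta] <;> fun_prop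

/-- The field `∂/∂θ` together with its covariant derivative. -/
def dThetaPair (a : ℝ) (q : ℝ≥0∞) : Lp E3 q (area a) × Lp T3 q (area a) :=
  ((memLp_of_continuous a q contDiff_dTheta.continuous).toLp dTheta,
   (memLp_of_continuous a q (continuous_covDeriv a contDiff_dTheta)).toLp (covDeriv a dTheta))

/-- The set of equilibria `{c ∂/∂θ : c ∈ ℝ}`. -/
def equilibria (a : ℝ) (q : ℝ≥0∞) : Set (Lp E3 q (area a) × Lp T3 q (area a)) :=
  {p | ∃ c : ℝ, p = c • dThetaPair a q}

end SphereFlow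

end

/-!
With coordinates numbered `0, 1, 2`, let `u` be in the kernel and `ℓ(P) = (u | x × ∇P)_M` for
polynomials `P` on `ℝ³`. Put `L = ∑ (x × ∇)_m²`, which is `a² Δ_M` on the sphere. Testing the
equation with the solenoidal field `x × ∇(L P)` and integrating by parts along the Killing fields
`e_m × x` gives `ℓ(L (L + 2) P + c (x × ∇)_2 P) = 0` with `c = -2 ω a² / μ_s`.

On homogeneous polynomials of degree `n`, `L` acts as `-n (n + 1)` up to `|x|²` times a polynomial
of lower degree, and `s + c (x × ∇)_2` is invertible for `s ≠ 0` because `(x × ∇)_2` is skew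
symmetric. So by induction on the degree `ℓ` is determined by its values in degree `1`, where the
Stokes part `L (L + 2)` vanishes and the Coriolis part forces `ℓ(X_0) = ℓ(X_1) = 0`. Since a
divergence-free field is determined by `ℓ`, `u` is a multiple of `x × ∇X_2`, that is, of `∂/∂θ`.

`helmholtzProj` has the junk value `0` at fields without a Helmholtz decomposition. If the Coriolis
term `C u` of a kernel element were such a field, then `u` would solve the Stokes equation, so it
would be a Killing field, and for these the decomposition of `C u` is explicit.
-/

noncomputable section

namespace SphereFlow

open scoped Pointwise
open MvPolynomial (X C pderiv)

section Rotations

variable {E : Type*} [NormedAddCommGroup E] [InnerProductSpace ℝ E] [FiniteDimensional ℝ E]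
  [MeasurableSpace E] [BorelSpace E]

theorem map_linearIsometryEquiv_map_toSphere (R : E ≃ₗᵢ[ℝ] E) :
    ((volume : Measure E).toSphere.map (↑)).map R =
      (volume : Measure E).toSphere.map ((↑) : sphere (0 : E) 1 → E) := by
  have hcoe : Measurable ((↑) : sphere (0 : E) 1 → E) := measurable_subtype_coe
  have hR : Measurable R := R.continuous.measurable
  ext s hs
  have hcone : Ioo (0 : ℝ) 1 • (R ⁻¹' s ∩ sphere (0 : E) 1) =
      R ⁻¹' (Ioo (0 : ℝ) 1 • (s ∩ sphere (0 : E) 1)) := by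
    ext y
    simp only [mem_smul, mem_preimage, mem_inter_iff, mem_sphere_zero_iff_norm]
    constructor
    · rintro ⟨r, hr, z, ⟨hzs, hz⟩, rfl⟩
      exact ⟨r, hr, R z, ⟨hzs, (R.norm_map z).trans hz⟩, (map_smul R r z).symm⟩
    · rintro ⟨r, hr, z, ⟨hzs, hz⟩, hzy⟩
      refine ⟨r, hr, R.symm z, ⟨by rwa [R.apply_symm_apply], (R.symm.norm_map z).trans hz⟩, ?_⟩
      rw [← map_smul, hzy, R.symm_apply_apply]
  rw [Measure.map_apply hR hs, Measure.map_apply hcoe (hR hs), Measure.map_apply hcoe hs,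
    Measure.toSphere_apply' _ (hcoe (hR hs)), Measure.toSphere_apply' _ (hcoe hs),
    Subtype.image_preimage_coe, Subtype.image_preimage_coe, inter_comm, hcone,
    inter_comm, R.measurePreserving.measure_preimage_emb R.toHomeomorph.measurableEmbedding]

theorem integrable_of_continuous_of_ae_mem {X : Type*} [TopologicalSpace X] [MeasurableSpace X]
    [OpensMeasurableSpace X] {μ : Measure X} [IsFiniteMeasure μ] {K : Set X} (hK : IsCompact K)
    (hKμ : ∀ᵐ x ∂μ, x ∈ K) {F : X → ℝ} (hF : Continuous F) : Integrable F μ := by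
  obtain ⟨C, hC⟩ := hK.exists_bound_of_continuousOn hF.continuousOn
  exact .of_bound hF.aestronglyMeasurable C (hKμ.mono hC)

theorem hasDerivAt_integral_comp_exp_smul {μ : Measure E} [IsFiniteMeasure μ] {K : Set E}
    (hK : IsCompact K) (hKμ : ∀ᵐ x ∂μ, x ∈ K) (A : E →L[ℝ] E) {F : E → ℝ} (hF : ContDiff ℝ 1 F) :
    HasDerivAt (fun t : ℝ => ∫ x, F (NormedSpace.exp (t • A) x) ∂μ)
      (∫ x, fderiv ℝ F x (A x) ∂μ) 0 := by
  let flow (t : ℝ) : E →L[ℝ] E := NormedSpace.exp (t • A)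
  let F' (t : ℝ) (x : E) : ℝ := fderiv ℝ F (flow t x) (flow t (A x))
  have hflow : Continuous fun p : ℝ × E => flow p.1 p.2 := by
    have : Continuous flow :=
      continuous_iff_continuousAt.2 fun t => (hasDerivAt_exp_smul_const A t).continuousAt
    fun_prop
  have hF' : Continuous fun p : ℝ × E => F' p.1 p.2 :=
    ((hF.continuous_fderiv one_ne_zero).comp hflow).clm_apply
      (hflow.comp (continuous_fst.prodMk (A.continuous.comp continuous_snd)))
  have hflow_deriv (x : E) (t : ℝ) : HasDerivAt (fun t => flow t x) (flow t (A x)) t := by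
    simpa [flow] using (hasDerivAt_exp_smul_const A t).clm_apply (hasDerivAt_const t x)
  have hF_deriv (x : E) (t : ℝ) : HasDerivAt (fun t => F (flow t x)) (F' t x) t :=
    (hF.differentiable one_ne_zero _).hasFDerivAt.comp_hasDerivAt t (hflow_deriv x t)
  obtain ⟨B, hB⟩ := ((isCompact_closedBall (0 : ℝ) 1).prod hK).exists_bound_of_continuousOn
    hF'.continuousOn
  have hsection (t : ℝ) : Continuous fun x => F (flow t x) :=
    hF.continuous.comp (flow t).continuous
  have h := (hasDerivAt_integral_of_dominated_loc_of_deriv_le (F := fun t x => F (flow t x))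
    (F' := F') (bound := fun _ => B) (ball_mem_nhds 0 one_pos)
    (.of_forall fun t => (hsection t).aestronglyMeasurable)
    (integrable_of_continuous_of_ae_mem hK hKμ (hsection 0))
    (hF'.comp (Continuous.prodMk_right 0)).aestronglyMeasurable
    (hKμ.mono fun x hx t ht => hB (t, x) ⟨ball_subset_closedBall ht, hx⟩)
    (integrable_const B) (.of_forall fun x t _ => hF_deriv x t)).2
  simpa only [F', flow, zero_smul, NormedSpace.exp_zero, one_apply_eq_self] using h

theorem integral_fderiv_eq_zero_of_mem_skewAdjoint {μ : Measure E} [IsFiniteMeasure μ] {K : Set E}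
    (hK : IsCompact K) (hKμ : ∀ᵐ x ∂μ, x ∈ K) (hμ : ∀ R : E ≃ₗᵢ[ℝ] E, μ.map R = μ)
    {A : E →L[ℝ] E} (hA : A ∈ skewAdjoint (E →L[ℝ] E)) {F : E → ℝ} (hF : ContDiff ℝ 1 F) :
    ∫ x, fderiv ℝ F x (A x) ∂μ = 0 := by
  have hinv (t : ℝ) : ∫ x, F (NormedSpace.exp (t • A) x) ∂μ = ∫ x, F x ∂μ := by
    let : NormedAlgebra ℚ (E →L[ℝ] E) := .restrictScalars ℚ ℝ _
    let R : E ≃ₗᵢ[ℝ] E := Unitary.linearIsometryEquiv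
      ⟨_, NormedSpace.exp_mem_unitary_of_mem_skewAdjoint (skewAdjoint.smul_mem t hA)⟩
    conv_rhs => rw [← hμ R]
    exact (R.toHomeomorph.measurableEmbedding.integral_map F).symm
  have h := hasDerivAt_integral_comp_exp_smul hK hKμ A hF
  simp only [hinv] at h
  exact h.unique (hasDerivAt_const 0 _)

end Rotations

theorem map_linearIsometryEquiv_area (a : ℝ) (R : E3 ≃ₗᵢ[ℝ] E3) : (area a).map R = area a := by
  have hR : Measurable R := R.continuous.measurable
  have harea : area a = ENNReal.ofReal (a ^ 2) •
      ((volume : Measure E3).toSphere.map (↑)).map (fun y : E3 => a • y) := by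
    rw [Measure.map_map (by fun_prop) (by fun_prop)]
    rfl
  have hcomm : R ∘ (fun y : E3 => a • y) = (fun y => a • y) ∘ R := funext (map_smul R a)
  rw [harea, Measure.map_smul, Measure.map_map hR (by fun_prop), hcomm,
    ← Measure.map_map (by fun_prop) hR, map_linearIsometryEquiv_map_toSphere]

theorem integrable_area_of_continuous (a : ℝ) {F : E3 → ℝ} (hF : Continuous F) :
    Integrable F (area a) :=
  integrable_of_continuous_of_ae_mem (isCompact_sphere 0 |a|) ae_mem_sphere hF

/-- The generator `x ↦ e_m × x` of the rotations about the `m`-th axis. Axes are indexed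
cyclically by `Fin 3`, so that `(e_m × x)_{m+1} = -x_{m+2}` and `(e_m × x)_{m+2} = x_{m+1}`. -/
def rotGen (m : Fin 3) : E3 →L[ℝ] E3 :=
  (EuclideanSpace.proj (m + 1)).smulRight (EuclideanSpace.single (m + 2) (1 : ℝ)) -
    (EuclideanSpace.proj (m + 2)).smulRight (EuclideanSpace.single (m + 1) (1 : ℝ))

theorem rotGen_apply (m : Fin 3) (x : E3) :
    rotGen m x = x (m + 1) • EuclideanSpace.single (m + 2) (1 : ℝ) -
      x (m + 2) • EuclideanSpace.single (m + 1) (1 : ℝ) := rfl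

theorem rotGen_mem_skewAdjoint (m : Fin 3) : rotGen m ∈ skewAdjoint (E3 →L[ℝ] E3) := by
  rw [skewAdjoint.mem_iff, ContinuousLinearMap.star_eq_adjoint, eq_comm,
    ContinuousLinearMap.eq_adjoint_iff]
  intro x y
  simp only [neg_apply, rotGen_apply, inner_neg_left, inner_sub_left, inner_sub_right,
    inner_smul_left, inner_smul_right, EuclideanSpace.inner_single_left,
    EuclideanSpace.inner_single_right, conj_trivial]
  ring

theorem integral_fderiv_rotGen (a : ℝ) (m : Fin 3) {F : E3 → ℝ} (hF : ContDiff ℝ 1 F) :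
    ∫ x, fderiv ℝ F x (rotGen m x) ∂(area a) = 0 :=
  integral_fderiv_eq_zero_of_mem_skewAdjoint (isCompact_sphere 0 |a|) ae_mem_sphere
    (map_linearIsometryEquiv_area a) (rotGen_mem_skewAdjoint m) hF

section PolynomialFunctions

variable {ι : Type*}

/-- Evaluation of polynomials in the Cartesian coordinates at a point of a Euclidean space. -/
def ev (x : EuclideanSpace ℝ ι) : MvPolynomial ι ℝ →ₐ[ℝ] ℝ := MvPolynomial.aeval x.ofLp

@[simp]
theorem ev_X (x : EuclideanSpace ℝ ι) (i : ι) : ev x (X i) = x i := MvPolynomial.aeval_X _ i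

@[simp]
theorem ev_C (x : EuclideanSpace ℝ ι) (c : ℝ) : ev x (C c) = c := MvPolynomial.aeval_C _ c

theorem continuous_ev (P : MvPolynomial ι ℝ) :
    Continuous (fun x : EuclideanSpace ℝ ι => ev x P) := by
  induction P using MvPolynomial.induction_on with
  | C c => simpa only [ev_C] using continuous_const
  | add P Q hP hQ =>
    simp only [map_add]
    exact hP.add hQ
  | mul_X P i hP =>
    simp only [map_mul, ev_X]
    exact hP.mul (by fun_prop)

theorem eq_zero_of_forall_ev_eq_zero {P : MvPolynomial ι ℝ}
    (h : ∀ x : EuclideanSpace ℝ ι, ev x P = 0) : P = 0 :=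
  MvPolynomial.funext fun y => by
    simpa [ev, MvPolynomial.aeval_eq_eval] using h (WithLp.toLp 2 y)

theorem exists_forall_mem_norm_ev_sub_lt {K : Set (EuclideanSpace ℝ ι)} (hK : IsCompact K)
    {g : EuclideanSpace ℝ ι → ℝ} (hg : Continuous g) {ε : ℝ} (hε : 0 < ε) :
    ∃ P : MvPolynomial ι ℝ, ∀ x ∈ K, ‖ev x P - g x‖ < ε := by
  let toContinuousMap : MvPolynomial ι ℝ →ₐ[ℝ] C(EuclideanSpace ℝ ι, ℝ) :=
    MvPolynomial.aeval fun i => ⟨fun x => x i, by fun_prop⟩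
  have hev (P : MvPolynomial ι ℝ) (x) : toContinuousMap P x = ev x P := by
    induction P using MvPolynomial.induction_on with
    | C c => simp [toContinuousMap]
    | add P Q hP hQ => simp [hP, hQ]
    | mul_X P i hP => simp [hP, toContinuousMap]
  have hsep : toContinuousMap.range.SeparatesPoints := by
    intro x y hxy
    obtain ⟨i, hi⟩ : ∃ i, x i ≠ y i := by
      by_contra! h
      exact hxy (PiLp.ext h)
    exact ⟨_, ⟨toContinuousMap (X i), ⟨X i, rfl⟩, rfl⟩, by simpa [hev] using hi⟩
  obtain ⟨_, ⟨P, rfl⟩, hP⟩ :=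
    ContinuousMap.exists_mem_subalgebra_near_continuous_of_isCompact_of_separatesPoints hsep
      ⟨g, hg⟩ hK hε
  exact ⟨P, fun x hx => by simpa [hev] using hP x hx⟩

theorem ev_smul_of_isHomogeneous [Finite ι] {n : ℕ} {P : MvPolynomial ι ℝ}
    (hP : P.IsHomogeneous n) (c : ℝ) (x : EuclideanSpace ℝ ι) :
    ev (c • x) P = c ^ n * ev x P := by
  cases nonempty_fintype ι
  simp only [ev, MvPolynomial.aeval_def, MvPolynomial.eval₂_eq', Finset.mul_sum]
  refine Finset.sum_congr rfl fun d hd => ?_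
  have hn : ∑ i, d i = n := by
    simpa [Finsupp.weight_apply, Finsupp.sum_fintype] using hP (MvPolynomial.mem_support_iff.1 hd)
  simp only [PiLp.smul_apply, smul_eq_mul, mul_pow, Finset.prod_mul_distrib,
    Finset.prod_pow_eq_pow_sum, hn]
  ring

theorem contDiff_ev [Fintype ι] {n : WithTop ℕ∞} (P : MvPolynomial ι ℝ) :
    ContDiff ℝ n (fun x : EuclideanSpace ℝ ι => ev x P) := by
  induction P using MvPolynomial.induction_on with
  | C c => simpa only [ev_C] using contDiff_const
  | add P Q hP hQ => simpa only [map_add] using hP.add hQ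
  | mul_X P i hP =>
    simp only [map_mul, ev_X]
    exact hP.mul (by fun_prop)

theorem fderiv_ev [Fintype ι] (P : MvPolynomial ι ℝ) (x e : EuclideanSpace ℝ ι) :
    fderiv ℝ (fun x => ev x P) x e = ∑ i, e i * ev x (pderiv i P) := by
  classical
  have hd (P : MvPolynomial ι ℝ) : DifferentiableAt ℝ (fun x => ev x P) x :=
    (contDiff_ev P).differentiable one_ne_zero x
  induction P using MvPolynomial.induction_on with
  | C c => simp
  | add P Q hP hQ =>
    simp only [map_add, fderiv_fun_add (hd P) (hd Q), add_apply, hP, hQ, mul_add,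
      Finset.sum_add_distrib]
  | mul_X P i hP =>
    have hXd : DifferentiableAt ℝ (fun x : EuclideanSpace ℝ ι => x i) x := by fun_prop
    have hX : fderiv ℝ (fun x : EuclideanSpace ℝ ι => x i) x = EuclideanSpace.proj i :=
      (EuclideanSpace.proj (𝕜 := ℝ) i).fderiv
    simp only [map_mul, ev_X, fderiv_fun_mul (hd P) hXd, hX, add_apply, smul_apply,
      PiLp.proj_apply, smul_eq_mul, hP, Derivation.leibniz, MvPolynomial.pderiv_X, map_add,
      Pi.single_apply, apply_ite (ev x), map_zero, mul_ite, mul_one, mul_zero, mul_add,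
      Finset.sum_add_distrib, Finset.sum_ite_eq, Finset.mem_univ, if_true, Finset.mul_sum]
    ring_nf

theorem eq_zero_of_isHomogeneous_of_sphere [Fintype ι] [Nonempty ι] {r : ℝ} (hr : 0 < r) {n : ℕ}
    {P : MvPolynomial ι ℝ} (hP : P.IsHomogeneous n)
    (h : ∀ x ∈ sphere (0 : EuclideanSpace ℝ ι) r, ev x P = 0) : P = 0 := by
  have hne (y : EuclideanSpace ℝ ι) (hy : y ≠ 0) : ev y P = 0 := by
    have hy' : ‖y‖ ≠ 0 := norm_ne_zero_iff.2 hy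
    have hx : (r * ‖y‖⁻¹) • y ∈ sphere (0 : EuclideanSpace ℝ ι) r := by
      simp [norm_smul, hy', abs_of_pos hr]
    have hev := h _ hx
    rw [ev_smul_of_isHomogeneous hP] at hev
    exact (mul_eq_zero.1 hev).resolve_left (by positivity)
  exact eq_zero_of_forall_ev_eq_zero fun y => congrFun
    ((continuous_ev P).ext_on (dense_compl_singleton 0) continuous_const hne) y

theorem integral_mul_eq_zero_of_forall_integral_mul_ev_eq_zero [Finite ι]
    {μ : Measure (EuclideanSpace ℝ ι)} {K : Set (EuclideanSpace ℝ ι)}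
    (hK : IsCompact K) (hKμ : ∀ᵐ x ∂μ, x ∈ K) {w : EuclideanSpace ℝ ι → ℝ} (hw : Integrable w μ)
    (h : ∀ P : MvPolynomial ι ℝ, ∫ x, w x * ev x P ∂μ = 0) {g : EuclideanSpace ℝ ι → ℝ}
    (hg : Continuous g) : ∫ x, w x * g x ∂μ = 0 := by
  have hint {f : EuclideanSpace ℝ ι → ℝ} (hf : Continuous f) :
      Integrable (fun x => w x * f x) μ := by
    obtain ⟨B, hB⟩ := hK.exists_bound_of_continuousOn hf.continuousOn
    exact hw.mul_bdd hf.aestronglyMeasurable (hKμ.mono hB)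
  have hbound (ε : ℝ) (hε : 0 < ε) : ‖∫ x, w x * g x ∂μ‖ ≤ ε * ∫ x, ‖w x‖ ∂μ := by
    obtain ⟨P, hP⟩ := exists_forall_mem_norm_ev_sub_lt hK hg hε
    calc ‖∫ x, w x * g x ∂μ‖ = ‖∫ x, (w x * ev x P - w x * g x) ∂μ‖ := by
          rw [integral_sub (hint (continuous_ev P)) (hint hg), h P, zero_sub, norm_neg]
      _ ≤ ∫ x, ε * ‖w x‖ ∂μ := by
          refine norm_integral_le_of_norm_le (hw.norm.const_mul ε) (hKμ.mono fun x hx => ?_)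
          rw [← mul_sub, norm_mul, mul_comm]
          gcongr
          exact (hP x hx).le
      _ = ε * ∫ x, ‖w x‖ ∂μ := integral_const_mul ε _
  have hlim : Filter.Tendsto (fun ε : ℝ => ε * ∫ x, ‖w x‖ ∂μ) (nhdsWithin 0 (Ioi 0)) (nhds 0) := by
    have h := (continuous_mul_const (∫ x, ‖w x‖ ∂μ)).tendsto 0
    rw [zero_mul] at h
    exact h.mono_left nhdsWithin_le_nhds
  exact norm_le_zero_iff.1 (ge_of_tendsto hlim (eventually_mem_nhdsWithin.mono hbound))

theorem ae_eq_zero_of_forall_integral_mul_ev_eq_zero [Finite ι]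
    {μ : Measure (EuclideanSpace ℝ ι)} {K : Set (EuclideanSpace ℝ ι)}
    (hK : IsCompact K) (hKμ : ∀ᵐ x ∂μ, x ∈ K)
    {w : EuclideanSpace ℝ ι → ℝ} (hw : Integrable w μ)
    (h : ∀ P : MvPolynomial ι ℝ, ∫ x, w x * ev x P ∂μ = 0) : ∀ᵐ x ∂μ, w x = 0 := by
  cases nonempty_fintype ι
  refine ae_eq_zero_of_integral_contDiff_smul_eq_zero hw.locallyIntegrable fun g hg _ => ?_
  simpa only [smul_eq_mul, mul_comm] using
    integral_mul_eq_zero_of_forall_integral_mul_ev_eq_zero hK hKμ hw h hg.continuous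

end PolynomialFunctions

theorem eqOn_sphere_of_ae_eq {a : ℝ} (ha : 0 < a) {Y : Type*} [TopologicalSpace Y] [T2Space Y]
    {F G : E3 → Y} (hF : Continuous F) (hG : Continuous G) (h : F =ᵐ[area a] G) :
    EqOn F G (sphere 0 a) := by
  have hscale : Measurable fun x : sphere (0 : E3) 1 => a • (x : E3) := by fun_prop
  have hweight : ENNReal.ofReal (a ^ 2) ≠ 0 := (ENNReal.ofReal_pos.2 (by positivity)).ne'
  have hunit : (fun x : sphere (0 : E3) 1 => F (a • (x : E3))) =ᵐ[(volume : Measure E3).toSphere]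
      fun x => G (a • (x : E3)) :=
    ae_of_ae_map hscale.aemeasurable ((Measure.ae_ennreal_smul_measure_iff hweight).1 h)
  have heq := Measure.eq_of_ae_eq hunit (hF.comp (by fun_prop)) (hG.comp (by fun_prop))
  intro x hx
  have hx' : a⁻¹ • x ∈ sphere (0 : E3) 1 := by
    rw [mem_sphere_zero_iff_norm] at hx ⊢
    rw [norm_smul, hx, norm_inv, Real.norm_of_nonneg ha.le, inv_mul_cancel₀ ha.ne']
  simpa [smul_inv_smul₀ ha.ne'] using congrFun heq ⟨_, hx'⟩

/-- Polynomials in the Cartesian coordinates of `ℝ³`. -/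
abbrev Poly : Type := MvPolynomial (Fin 3) ℝ

theorem eq_zero_of_integral_ev_mul_self_eq_zero {a : ℝ} (ha : 0 < a) {n : ℕ} {P : Poly}
    (hP : P.IsHomogeneous n) (h : ∫ x, ev x P * ev x P ∂(area a) = 0) : P = 0 := by
  have hsq : Continuous fun x : E3 => ev x P * ev x P := (continuous_ev P).mul (continuous_ev P)
  have hae : (fun x => ev x P * ev x P) =ᵐ[area a] 0 :=
    (integral_eq_zero_iff_of_nonneg (fun _ => mul_self_nonneg _)
      (integrable_area_of_continuous a hsq)).1 h
  exact eq_zero_of_isHomogeneous_of_sphere ha hP fun x hx =>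
    mul_self_eq_zero.1 (eqOn_sphere_of_ae_eq ha hsq continuous_const hae hx)

section PolynomialOperators

variable {σ R : Type*} [CommRing R]

theorem pderiv_comm (i j : σ) (P : MvPolynomial σ R) :
    pderiv i (pderiv j P) = pderiv j (pderiv i P) := by
  classical
  let D (k : σ) : Derivation R (MvPolynomial σ R) (MvPolynomial σ R) := pderiv k
  have h : ⁅D i, D j⁆ = 0 := MvPolynomial.derivation_ext fun k => by
    simp [D, Derivation.commutator_apply, MvPolynomial.pderiv_X, Pi.single_apply, apply_ite]
  simpa [D, Derivation.commutator_apply, sub_eq_zero] using DFunLike.congr_fun h P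

theorem eq_zero_of_forall_isHomogeneous {M : Type*} [AddCommGroup M] [Module R M]
    {ℓ : MvPolynomial σ R →ₗ[R] M} (h : ∀ n P, P.IsHomogeneous n → ℓ P = 0) : ℓ = 0 := by
  refine LinearMap.ext fun P => ?_
  rw [← MvPolynomial.sum_homogeneousComponent P, map_sum, LinearMap.zero_apply]
  exact Finset.sum_eq_zero fun n _ => h n _ (MvPolynomial.homogeneousComponent_isHomogeneous n P)

theorem exists_eq_C_of_isHomogeneous_zero {P : MvPolynomial σ R} (hP : P.IsHomogeneous 0) :
    ∃ c, P = C c :=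
  ⟨_, MvPolynomial.totalDegree_eq_zero_iff_eq_C.1 (Nat.le_zero.1 hP.totalDegree_le)⟩

variable [Fintype σ]

/-- The polynomial `|x|²`. -/
def normSq : MvPolynomial σ R := ∑ i, X i * X i

/-- The Euclidean Laplacian. -/
def laplacian : MvPolynomial σ R →ₗ[R] MvPolynomial σ R :=
  ∑ i, (pderiv i).toLinearMap ∘ₗ (pderiv i).toLinearMap

/-- The Euler operator `x · ∇`. -/
def euler : Derivation R (MvPolynomial σ R) (MvPolynomial σ R) :=
  ∑ i, (X i : MvPolynomial σ R) • pderiv i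

theorem laplacian_apply (P : MvPolynomial σ R) : laplacian P = ∑ i, pderiv i (pderiv i P) := by
  simp [laplacian]

theorem euler_apply (P : MvPolynomial σ R) : euler P = ∑ i, X i * pderiv i P := by
  simp only [euler, ← Derivation.coeFnAddMonoidHom_apply, map_sum, Finset.sum_apply]
  rfl

theorem euler_X (i : σ) : euler (X i : MvPolynomial σ R) = X i := by
  classical
  simp [euler_apply, MvPolynomial.pderiv_X, Pi.single_apply]

theorem pderiv_euler (k : σ) (P : MvPolynomial σ R) :
    pderiv k (euler P) = euler (pderiv k P) + pderiv k P := by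
  classical
  simp only [euler_apply, map_sum, Derivation.leibniz, MvPolynomial.pderiv_X, Pi.single_apply,
    smul_eq_mul, mul_ite, mul_one, mul_zero, Finset.sum_add_distrib, Finset.sum_ite_eq',
    Finset.mem_univ, if_true, pderiv_comm k]

theorem euler_of_isHomogeneous {n : ℕ} {P : MvPolynomial σ R} (hP : P.IsHomogeneous n) :
    euler P = n • P := by
  rw [euler_apply, hP.sum_X_mul_pderiv]

theorem isHomogeneous_laplacian {n : ℕ} {P : MvPolynomial σ R} (hP : P.IsHomogeneous (n + 2)) :
    (laplacian P).IsHomogeneous n := by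
  rw [laplacian_apply]
  exact .sum _ _ _ fun _ _ => hP.pderiv.pderiv

theorem laplacian_of_isHomogeneous_one {P : MvPolynomial σ R} (hP : P.IsHomogeneous 1) :
    laplacian P = 0 := by
  rw [laplacian_apply]
  refine Finset.sum_eq_zero fun i _ => ?_
  obtain ⟨c, hc⟩ := exists_eq_C_of_isHomogeneous_zero (hP.pderiv (i := i))
  rw [hc, MvPolynomial.pderiv_C]

end PolynomialOperators

section RotationDerivations

/-- The derivation `(x × ∇)_m`, which differentiates along `rotGen m`. -/
def rotDeriv (m : Fin 3) : Derivation ℝ Poly Poly :=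
  (X (m + 1) : Poly) • pderiv (m + 2) - (X (m + 2) : Poly) • pderiv (m + 1)

/-- The operator `∑ (x × ∇)_m²`: it is `|x|²` times the Laplace-Beltrami operator of the spheres
centred at the origin. -/
def sphLaplacian : Poly →ₗ[ℝ] Poly :=
  ∑ m : Fin 3, (rotDeriv m).toLinearMap ∘ₗ (rotDeriv m).toLinearMap

theorem rotDeriv_apply (m : Fin 3) (P : Poly) :
    rotDeriv m P = X (m + 1) * pderiv (m + 2) P - X (m + 2) * pderiv (m + 1) P := rfl

theorem rotDeriv_zero (P : Poly) : rotDeriv 0 P = X 1 * pderiv 2 P - X 2 * pderiv 1 P := rfl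

theorem rotDeriv_one (P : Poly) : rotDeriv 1 P = X 2 * pderiv 0 P - X 0 * pderiv 2 P := rfl

theorem rotDeriv_two (P : Poly) : rotDeriv 2 P = X 0 * pderiv 1 P - X 1 * pderiv 0 P := rfl

theorem sphLaplacian_apply (P : Poly) : sphLaplacian P = ∑ m, rotDeriv m (rotDeriv m P) := by
  simp [sphLaplacian]

theorem fderiv_rotGen (m : Fin 3) (F : E3 → ℝ) (x : E3) :
    fderiv ℝ F x (rotGen m x) = x (m + 1) * fderiv ℝ F x (EuclideanSpace.single (m + 2) 1) -
      x (m + 2) * fderiv ℝ F x (EuclideanSpace.single (m + 1) 1) := by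
  simp only [rotGen_apply, map_sub, map_smul, smul_eq_mul]

theorem fderiv_ev_rotGen (m : Fin 3) (P : Poly) (x : E3) :
    fderiv ℝ (fun x => ev x P) x (rotGen m x) = ev x (rotDeriv m P) := by
  rw [fderiv_rotGen, fderiv_ev, fderiv_ev]
  simp [rotDeriv_apply, PiLp.single_apply]

theorem integral_rotDeriv (a : ℝ) (m : Fin 3) (P : Poly) :
    ∫ x, ev x (rotDeriv m P) ∂(area a) = 0 := by
  simpa only [fderiv_ev_rotGen] using integral_fderiv_rotGen a m (contDiff_ev P)

theorem integral_rotDeriv_mul_self (a : ℝ) (m : Fin 3) (P : Poly) :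
    ∫ x, ev x (rotDeriv m P) * ev x P ∂(area a) = 0 := by
  have h := integral_rotDeriv a m (P * P)
  have hsq (x : E3) : ev x (rotDeriv m (P * P)) = 2 * (ev x (rotDeriv m P) * ev x P) := by
    simp only [Derivation.leibniz, smul_eq_mul, map_add, map_mul]
    ring
  simp only [hsq, integral_const_mul] at h
  exact (mul_eq_zero.1 h).resolve_left two_ne_zero

theorem isHomogeneous_rotDeriv {n : ℕ} {P : Poly} (hP : P.IsHomogeneous n) (m : Fin 3) :
    (rotDeriv m P).IsHomogeneous n := by
  rcases n with _ | n
  · obtain ⟨c, rfl⟩ := exists_eq_C_of_isHomogeneous_zero hP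
    simpa [rotDeriv_apply] using MvPolynomial.isHomogeneous_zero (Fin 3) ℝ 0
  · have h (i j : Fin 3) : (X i * pderiv j P).IsHomogeneous (n + 1) := by
      simpa [add_comm] using (MvPolynomial.isHomogeneous_X ℝ i).mul (hP.pderiv (i := j))
    exact (h _ _).sub (h _ _)

theorem isHomogeneous_sphLaplacian {n : ℕ} {P : Poly} (hP : P.IsHomogeneous n) :
    (sphLaplacian P).IsHomogeneous n := by
  rw [sphLaplacian_apply]
  exact .sum _ _ _ fun m _ => isHomogeneous_rotDeriv (isHomogeneous_rotDeriv hP m) m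

theorem rotDeriv_normSq_mul (m : Fin 3) (P : Poly) :
    rotDeriv m (normSq * P) = normSq * rotDeriv m P := by
  have h : rotDeriv m normSq = 0 := by
    rw [rotDeriv_apply]
    simp only [normSq, map_sum, Derivation.leibniz, MvPolynomial.pderiv_X,
      Pi.single_apply, smul_eq_mul, mul_ite, mul_one, mul_zero, Finset.sum_add_distrib,
      Finset.sum_ite_eq', Finset.mem_univ, if_true]
    ring
  simp [Derivation.leibniz, h]

theorem sphLaplacian_normSq_mul (P : Poly) :
    sphLaplacian (normSq * P) = normSq * sphLaplacian P := by
  simp only [sphLaplacian_apply, rotDeriv_normSq_mul, Finset.mul_sum]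

theorem sphLaplacian_eq (P : Poly) :
    sphLaplacian P = normSq * laplacian P - euler (euler P) - euler P := by
  simp only [sphLaplacian_apply, laplacian_apply, euler_apply, normSq, Fin.sum_univ_three,
    rotDeriv_zero, rotDeriv_one, rotDeriv_two, map_add, map_sub, Derivation.leibniz, smul_eq_mul,
    MvPolynomial.pderiv_X, Pi.single_apply, pderiv_comm]
  simp only [Fin.isValue, Fin.reduceEq, ↓reduceIte, mul_zero, mul_one, add_zero, zero_add]
  ring

theorem sphLaplacian_of_isHomogeneous {n : ℕ} {P : Poly} (hP : P.IsHomogeneous n) :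
    sphLaplacian P = normSq * laplacian P - ((n : ℝ) * (n + 1)) • P := by
  rw [sphLaplacian_eq, euler_of_isHomogeneous hP, map_nsmul, euler_of_isHomogeneous hP]
  module

theorem euler_rotDeriv (m : Fin 3) (P : Poly) : euler (rotDeriv m P) = rotDeriv m (euler P) := by
  simp only [rotDeriv_apply, map_sub, Derivation.leibniz, euler_X, pderiv_euler, smul_eq_mul]
  ring

theorem laplacian_rotDeriv (m : Fin 3) (P : Poly) :
    laplacian (rotDeriv m P) = rotDeriv m (laplacian P) := by
  simp only [laplacian_apply, rotDeriv_apply, map_add, map_sub, map_sum, Derivation.leibniz,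
    smul_eq_mul, MvPolynomial.pderiv_X, Pi.single_apply, pderiv_comm, mul_ite, mul_one,
    mul_zero, Finset.sum_add_distrib, Finset.sum_sub_distrib, Finset.sum_ite_eq, Finset.mem_univ,
    if_true, apply_ite (pderiv _), map_zero]
  ring_nf

theorem sum_X_mul_rotDeriv (P : Poly) : ∑ k, X k * rotDeriv k P = 0 := by
  simp only [Fin.sum_univ_three, rotDeriv_zero, rotDeriv_one, rotDeriv_two]
  ring

theorem sum_pderiv_rotDeriv (P : Poly) : ∑ k, pderiv k (rotDeriv k P) = 0 := by
  simp [Fin.sum_univ_three, rotDeriv_zero, rotDeriv_one, rotDeriv_two, Derivation.leibniz,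
    MvPolynomial.pderiv_X, pderiv_comm]

theorem sum_X_mul_pderiv_rotDeriv (l : Fin 3) (P : Poly) :
    ∑ k, X k * pderiv l (rotDeriv k P) = -rotDeriv l P := by
  have h := congrArg (pderiv l) (sum_X_mul_rotDeriv P)
  simp only [map_sum, Derivation.leibniz, smul_eq_mul, map_zero, Finset.sum_add_distrib,
    MvPolynomial.pderiv_X, Pi.single_apply, mul_ite, mul_one, mul_zero, Finset.sum_ite_eq',
    Finset.mem_univ, if_true] at h
  exact eq_neg_of_add_eq_zero_left h

end RotationDerivations

section FunctionalsOnSphere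

variable {a : ℝ} {ℓ : Poly →ₗ[ℝ] ℝ}

theorem eq_zero_of_comp_sphLaplacian_eq_zero (hr : ∀ P, ℓ (normSq * P) = a ^ 2 * ℓ P)
    (h0 : ∀ c, ℓ (C c) = 0) (h : ∀ P, ℓ (sphLaplacian P) = 0) : ℓ = 0 := by
  refine eq_zero_of_forall_isHomogeneous fun n => ?_
  induction n using Nat.strong_induction_on with
  | _ n ih =>
    intro P hP
    have hn := h P
    rw [sphLaplacian_of_isHomogeneous hP, map_sub, hr, map_smul, smul_eq_mul] at hn
    rcases n with _ | _ | n
    · obtain ⟨c, rfl⟩ := exists_eq_C_of_isHomogeneous_zero hP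
      exact h0 c
    · rw [laplacian_of_isHomogeneous_one hP, map_zero, mul_zero, zero_sub, neg_eq_zero] at hn
      exact (mul_eq_zero.1 hn).resolve_left (by norm_num)
    · rw [ih n (by lia) _ (isHomogeneous_laplacian hP), mul_zero, zero_sub, neg_eq_zero] at hn
      exact (mul_eq_zero.1 hn).resolve_left (by positivity)

theorem eq_zero_of_smul_add_smul_rotDeriv_eq_zero {s : ℝ} (hs : s ≠ 0) {c : ℝ} {m : Fin 3} {n : ℕ}
    {P : Poly} (hP : P.IsHomogeneous n) (h : s • P + c • rotDeriv m P = 0) : P = 0 := by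
  refine eq_zero_of_integral_ev_mul_self_eq_zero one_pos hP ?_
  have hsq (x : E3) : ev x P * ev x P = -(c / s) * (ev x (rotDeriv m P) * ev x P) := by
    have hx := congrArg (ev x) h
    simp only [map_add, map_smul, smul_eq_mul, map_zero] at hx
    field_simp
    linear_combination ev x P * hx
  simp only [hsq, integral_const_mul, integral_rotDeriv_mul_self, mul_zero]

theorem exists_smul_add_smul_rotDeriv_eq {s : ℝ} (hs : s ≠ 0) (c : ℝ) (m : Fin 3) {n : ℕ}
    {P : Poly} (hP : P.IsHomogeneous n) :
    ∃ Q : Poly, Q.IsHomogeneous n ∧ s • Q + c • rotDeriv m Q = P := by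
  let V := MvPolynomial.homogeneousSubmodule (Fin 3) ℝ n
  have : Module.Finite ℝ V :=
    Module.Finite.iff_fg.2 (MvPolynomial.homogeneousSubmodule_fg (Fin 3) ℝ n)
  let D : Poly →ₗ[ℝ] Poly := s • LinearMap.id + c • (rotDeriv m).toLinearMap
  let T : V →ₗ[ℝ] V := D.restrict fun Q hQ =>
    V.add_mem (V.smul_mem s hQ) (V.smul_mem c (isHomogeneous_rotDeriv hQ m))
  have hinj : Function.Injective T := (injective_iff_map_eq_zero T).2 fun Q hQ =>
    Subtype.ext (eq_zero_of_smul_add_smul_rotDeriv_eq_zero hs Q.2 (congrArg Subtype.val hQ))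
  obtain ⟨Q, hQ⟩ := LinearMap.injective_iff_surjective.1 hinj ⟨P, hP⟩
  exact ⟨Q, Q.2, congrArg Subtype.val hQ⟩

theorem sphLaplacian_sphLaplacian_add_of_isHomogeneous {n : ℕ} {Q : Poly}
    (hQ : Q.IsHomogeneous n) {N : ℝ} (hN : N = n * (n + 1)) :
    sphLaplacian (sphLaplacian Q) + (2 : ℝ) • sphLaplacian Q =
      (N ^ 2 - 2 * N) • Q +
        normSq * (sphLaplacian (laplacian Q) + (2 - N) • laplacian Q) := by
  rw [sphLaplacian_of_isHomogeneous hQ, ← hN, map_sub, sphLaplacian_normSq_mul, map_smul,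
    sphLaplacian_of_isHomogeneous hQ, ← hN]
  simp only [MvPolynomial.smul_eq_C_mul, map_sub, map_mul, map_pow, map_ofNat]
  ring

theorem eq_zero_of_comp_stokes_add_coriolis_eq_zero {c : ℝ} {m : Fin 3}
    (hr : ∀ P, ℓ (normSq * P) = a ^ 2 * ℓ P) (h0 : ∀ c, ℓ (C c) = 0)
    (h1 : ∀ P : Poly, P.IsHomogeneous 1 → ℓ P = 0)
    (h : ∀ P, ℓ (sphLaplacian (sphLaplacian P) + (2 : ℝ) • sphLaplacian P + c • rotDeriv m P) = 0) :
    ℓ = 0 := by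
  refine eq_zero_of_forall_isHomogeneous fun n => ?_
  induction n using Nat.strong_induction_on with
  | _ n ih =>
    intro P hP
    rcases n with _ | _ | n
    · obtain ⟨c, rfl⟩ := exists_eq_C_of_isHomogeneous_zero hP
      exact h0 c
    · exact h1 P hP
    · obtain ⟨N, hN⟩ : ∃ N : ℝ, N = (n + 2 : ℕ) * ((n + 2 : ℕ) + 1) := ⟨_, rfl⟩
      have hs : N ^ 2 - 2 * N ≠ 0 := by
        have hN6 : 6 ≤ N := by
          rw [hN]
          push_cast
          nlinarith [(Nat.cast_nonneg n : (0 : ℝ) ≤ n)]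
        nlinarith
      obtain ⟨Q, hQ, rfl⟩ := exists_smul_add_smul_rotDeriv_eq hs c m hP
      have hlap := isHomogeneous_laplacian hQ
      have hlow : ℓ (normSq * (sphLaplacian (laplacian Q) + (2 - N) • laplacian Q)) = 0 := by
        rw [hr, map_add, map_smul, ih n (by lia) _ (isHomogeneous_sphLaplacian hlap),
          ih n (by lia) _ hlap, smul_zero, add_zero, mul_zero]
      have hQ0 := h Q
      rwa [sphLaplacian_sphLaplacian_add_of_isHomogeneous hQ hN, add_right_comm, map_add, hlow,
        add_zero] at hQ0

end FunctionalsOnSphere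

section RotationalFields

theorem euler_pderiv {σ R : Type*} [CommRing R] [Fintype σ] (k : σ) (P : MvPolynomial σ R) :
    euler (pderiv k P) = pderiv k (euler P - P) := by
  rw [map_sub, pderiv_euler, add_sub_cancel_right]

/-- Twice the deformation tensor of the field `x × ∇P` on the sphere of radius `a`, see
`symPart_covDeriv_rotField`. -/
def rotDeformation (a : ℝ) (P : Poly) (k l : Fin 3) : Poly :=
  pderiv l (rotDeriv k P) + pderiv k (rotDeriv l P) +
    C (a ^ 2)⁻¹ * (X k * rotDeriv l (P - euler P) + rotDeriv k (P - euler P) * X l)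

/-- The surface divergence, on the sphere of radius `a`, of a polynomial field that is tangential
there: the Euclidean divergence minus the normal part of the normal derivative. -/
def surfaceDiv (a : ℝ) (W : Fin 3 → Poly) : Poly :=
  ∑ l, pderiv l (W l) - C (a ^ 2)⁻¹ * ∑ l, X l * euler (W l)

theorem sum_X_mul_rotDeformation (a : ℝ) (P : Poly) (k : Fin 3) :
    ∑ l, X l * rotDeformation a P k l =
      (C (a ^ 2)⁻¹ * normSq - 1) * rotDeriv k (P - euler P) := by
  have h : ∑ l, X l * rotDeformation a P k l =
      euler (rotDeriv k P) + ∑ l, X l * pderiv k (rotDeriv l P) +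
        C (a ^ 2)⁻¹ * (X k * ∑ l, X l * rotDeriv l (P - euler P)) +
        C (a ^ 2)⁻¹ * (rotDeriv k (P - euler P) * normSq) := by
    simp only [rotDeformation, euler_apply, normSq, Finset.mul_sum, ← Finset.sum_add_distrib]
    exact Finset.sum_congr rfl fun l _ => by ring
  rw [h, sum_X_mul_pderiv_rotDeriv, sum_X_mul_rotDeriv, euler_rotDeriv, map_sub]
  ring

theorem sum_pderiv_rotDeformation (a : ℝ) (P : Poly) (k : Fin 3) :
    ∑ l, pderiv l (rotDeformation a P k l) =
      rotDeriv k (laplacian P) +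
        C (a ^ 2)⁻¹ * (4 * rotDeriv k (P - euler P) + rotDeriv k (euler (P - euler P))) := by
  have h (G : Poly) : ∑ l, pderiv l (X k * rotDeriv l G + rotDeriv k G * X l) =
      X k * ∑ l, pderiv l (rotDeriv l G) + 4 * rotDeriv k G + euler (rotDeriv k G) := by
    simp only [map_add, Derivation.leibniz, smul_eq_mul, MvPolynomial.pderiv_X, Pi.single_apply,
      mul_ite, mul_one, mul_zero, Finset.sum_add_distrib, Finset.sum_ite_eq, Finset.mem_univ,
      if_true, Finset.sum_const, Finset.card_univ, Fintype.card_fin, nsmul_eq_mul, euler_apply,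
      Finset.mul_sum]
    push_cast
    ring
  have hP : ∑ l, pderiv l (rotDeformation a P k l) =
      laplacian (rotDeriv k P) + pderiv k (∑ l, pderiv l (rotDeriv l P)) +
        C (a ^ 2)⁻¹ * ∑ l, pderiv l (X k * rotDeriv l (P - euler P) +
          rotDeriv k (P - euler P) * X l) := by
    simp only [rotDeformation, map_add (pderiv _) (_ + _), map_add (pderiv _) (pderiv _ _),
      MvPolynomial.pderiv_C_mul, laplacian_apply, map_sum, pderiv_comm k, Finset.sum_add_distrib,
      Finset.mul_sum]
  rw [hP, h, sum_pderiv_rotDeriv, sum_pderiv_rotDeriv, laplacian_rotDeriv, euler_rotDeriv]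
  simp only [map_zero, mul_zero, zero_add, add_zero]

theorem sum_X_mul_euler_rotDeformation (a : ℝ) (P : Poly) (k : Fin 3) :
    ∑ l, X l * euler (rotDeformation a P k l) =
      rotDeriv k (P - euler P - euler (P - euler P)) +
        C (a ^ 2)⁻¹ * (normSq * rotDeriv k (P - euler (euler P))) := by
  have h (l : Fin 3) : euler (rotDeformation a P k l) =
      pderiv l (rotDeriv k (euler P - P)) + pderiv k (rotDeriv l (euler P - P)) +
        C (a ^ 2)⁻¹ * (X k * rotDeriv l (P - euler (euler P)) +
          rotDeriv k (P - euler (euler P)) * X l) := by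
    simp only [rotDeformation, map_add, map_sub, Derivation.leibniz, MvPolynomial.derivation_C,
      euler_pderiv, euler_X, euler_rotDeriv, smul_eq_mul]
    ring
  have hsum : ∑ l, X l * euler (rotDeformation a P k l) =
      euler (rotDeriv k (euler P - P)) + ∑ l, X l * pderiv k (rotDeriv l (euler P - P)) +
        C (a ^ 2)⁻¹ * (X k * ∑ l, X l * rotDeriv l (P - euler (euler P)) +
          rotDeriv k (P - euler (euler P)) * normSq) := by
    simp only [h, euler_apply (rotDeriv _ _), normSq, Finset.mul_sum, ← Finset.sum_add_distrib]
    exact Finset.sum_congr rfl fun l _ => by ring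
  rw [hsum, sum_X_mul_pderiv_rotDeriv, sum_X_mul_rotDeriv, euler_rotDeriv]
  simp only [map_sub]
  ring

theorem ev_normSq {ι : Type*} [Fintype ι] (x : EuclideanSpace ℝ ι) : ev x normSq = ‖x‖ ^ 2 := by
  simp [normSq, EuclideanSpace.norm_sq_eq, ← sq]

theorem ev_normSq_of_mem_sphere {ι : Type*} [Fintype ι] {a : ℝ} {x : EuclideanSpace ℝ ι}
    (hx : x ∈ sphere 0 a) : ev x normSq = a ^ 2 := by
  rw [ev_normSq, mem_sphere_zero_iff_norm.1 hx]

theorem ev_surfaceDiv_rotDeformation {a : ℝ} (ha : a ≠ 0) {x : E3} (hx : x ∈ sphere 0 a)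
    (P : Poly) (k : Fin 3) :
    ev x (surfaceDiv a (rotDeformation a P k)) =
      (a ^ 2)⁻¹ * ev x (rotDeriv k (sphLaplacian P + (2 : ℝ) • P)) := by
  rw [surfaceDiv, sum_pderiv_rotDeformation, sum_X_mul_euler_rotDeformation, sphLaplacian_eq]
  simp only [map_add, map_sub, map_mul, map_ofNat, ev_C, Derivation.map_smul, map_smul,
    smul_eq_mul, rotDeriv_normSq_mul, ev_normSq_of_mem_sphere hx]
  field_simp
  ring

end RotationalFields

section IntegrationByParts

theorem integral_mul_fderiv_rotGen (a : ℝ) (m : Fin 3) {f g : E3 → ℝ} (hf : ContDiff ℝ 1 f)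
    (hg : ContDiff ℝ 1 g) :
    ∫ x, g x * fderiv ℝ f x (rotGen m x) ∂(area a) =
      -∫ x, f x * fderiv ℝ g x (rotGen m x) ∂(area a) := by
  have hint {f g : E3 → ℝ} (hf : ContDiff ℝ 1 f) (hg : ContDiff ℝ 1 g) :
      Integrable (fun x => g x * fderiv ℝ f x (rotGen m x)) (area a) :=
    integrable_area_of_continuous a (hg.continuous.mul
      ((hf.continuous_fderiv one_ne_zero).clm_apply (rotGen m).continuous))
  have hprod (x : E3) : fderiv ℝ (fun x => g x * f x) x (rotGen m x) =
      g x * fderiv ℝ f x (rotGen m x) + f x * fderiv ℝ g x (rotGen m x) := by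
    rw [fderiv_fun_mul (hg.differentiable one_ne_zero x) (hf.differentiable one_ne_zero x)]
    rfl
  have h := integral_fderiv_rotGen a m (hg.mul hf)
  simp only [hprod] at h
  rw [integral_add (hint hf hg) (hint hg hf)] at h
  exact eq_neg_of_add_eq_zero_left h

theorem integral_sum_ev_mul_fderiv_rotGen (a : ℝ) (Z : Fin 3 → Poly) {f : E3 → ℝ}
    (hf : ContDiff ℝ 1 f) :
    ∫ x, ∑ m, ev x (Z m) * fderiv ℝ f x (rotGen m x) ∂(area a) =
      -∫ x, f x * ev x (∑ m, rotDeriv m (Z m)) ∂(area a) := by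
  have hleft (m : Fin 3) :
      Integrable (fun x => ev x (Z m) * fderiv ℝ f x (rotGen m x)) (area a) :=
    integrable_area_of_continuous a ((continuous_ev _).mul
      ((hf.continuous_fderiv one_ne_zero).clm_apply (rotGen m).continuous))
  have hright (m : Fin 3) : Integrable (fun x => f x * ev x (rotDeriv m (Z m))) (area a) :=
    integrable_area_of_continuous a (hf.continuous.mul (continuous_ev _))
  simp only [map_sum, Finset.mul_sum]
  rw [integral_finsetSum _ fun m _ => hleft m, integral_finsetSum _ fun m _ => hright m,
    ← Finset.sum_neg_distrib]
  exact Finset.sum_congr rfl fun m _ => by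
    simpa only [fderiv_ev_rotGen] using integral_mul_fderiv_rotGen a m hf (contDiff_ev (Z m))

/-- The vector product `x × W` of the position and a polynomial field. -/
def crossX (W : Fin 3 → Poly) (m : Fin 3) : Poly := X (m + 1) * W (m + 2) - X (m + 2) * W (m + 1)

theorem sum_rotDeriv_crossX (W : Fin 3 → Poly) :
    ∑ m, rotDeriv m (crossX W m) =
      normSq * ∑ l, pderiv l (W l) - 2 * ∑ l, X l * W l - ∑ l, X l * euler (W l) := by
  simp only [crossX, normSq, Fin.sum_univ_three, rotDeriv_zero, rotDeriv_one, rotDeriv_two,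
    euler_apply, map_sub, Derivation.leibniz, smul_eq_mul, MvPolynomial.pderiv_X, Pi.single_apply]
  simp only [Fin.isValue, Fin.reduceAdd, Fin.reduceEq, ↓reduceIte, mul_zero, mul_one]
  ring

theorem fderiv_eq_sum {ι F : Type*} [Fintype ι] [DecidableEq ι] [NormedAddCommGroup F]
    [NormedSpace ℝ F] (f : EuclideanSpace ℝ ι → F) (x e : EuclideanSpace ℝ ι) :
    fderiv ℝ f x e = ∑ l, e l • fderiv ℝ f x (EuclideanSpace.single l 1) := by
  conv_lhs => rw [← (EuclideanSpace.basisFun ι ℝ).sum_repr e]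
  simp

theorem sum_crossX_mul_fderiv_rotGen (W : Fin 3 → Poly) (f : E3 → ℝ) (x : E3) :
    ∑ m, ev x (crossX W m) * fderiv ℝ f x (rotGen m x) =
      ev x normSq * ∑ l, ev x (W l) * fderiv ℝ f x (EuclideanSpace.single l 1) -
        ev x (∑ l, X l * W l) * fderiv ℝ f x x := by
  rw [fderiv_eq_sum f x x]
  simp only [crossX, normSq, fderiv_rotGen, Fin.sum_univ_three, map_add, map_sub, map_mul, ev_X,
    smul_eq_mul, Fin.isValue, Fin.reduceAdd]
  ring

theorem ae_mem_sphere_of_pos {a : ℝ} (ha : 0 < a) : ∀ᵐ x ∂(area a), x ∈ sphere (0 : E3) a := by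
  simpa [abs_of_pos ha] using ae_mem_sphere (a := a)

theorem integral_sum_mul_fderiv {a : ℝ} (ha : 0 < a) {W : Fin 3 → Poly}
    (hW : ∀ x ∈ sphere (0 : E3) a, ev x (∑ l, X l * W l) = 0) {f : E3 → ℝ}
    (hf : ContDiff ℝ 1 f) :
    ∫ x, ∑ l, ev x (W l) * fderiv ℝ f x (EuclideanSpace.single l 1) ∂(area a) =
      -∫ x, f x * ev x (surfaceDiv a W) ∂(area a) := by
  have h := integral_sum_ev_mul_fderiv_rotGen a (crossX W) hf
  have hleft : ∀ᵐ x ∂(area a), ∑ m, ev x (crossX W m) * fderiv ℝ f x (rotGen m x) =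
      a ^ 2 * ∑ l, ev x (W l) * fderiv ℝ f x (EuclideanSpace.single l 1) := by
    filter_upwards [ae_mem_sphere_of_pos ha] with x hx
    rw [sum_crossX_mul_fderiv_rotGen, hW x hx, ev_normSq_of_mem_sphere hx, zero_mul, sub_zero]
  have hright : ∀ᵐ x ∂(area a), f x * ev x (∑ m, rotDeriv m (crossX W m)) =
      a ^ 2 * (f x * ev x (surfaceDiv a W)) := by
    filter_upwards [ae_mem_sphere_of_pos ha] with x hx
    rw [sum_rotDeriv_crossX, surfaceDiv]
    simp only [map_sub, map_mul, ev_normSq_of_mem_sphere hx, hW x hx, ev_C]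
    field_simp
    ring
  rw [integral_congr_ae hleft, integral_congr_ae hright, integral_const_mul, integral_const_mul,
    ← mul_neg] at h
  exact mul_left_cancel₀ (by positivity) h

end IntegrationByParts

section CovariantDerivative

theorem inner_eq_sum {ι : Type*} [Fintype ι] (u v : EuclideanSpace ℝ ι) :
    ⟪u, v⟫ = ∑ i, u i * v i := by
  simp [PiLp.inner_apply, mul_comm]

/-- A polynomial vector field. -/
def polyField (W : Fin 3 → Poly) (x : E3) : E3 := WithLp.toLp 2 fun k => ev x (W k)

/-- A polynomial tensor field. -/
def polyTensor (S : Fin 3 → Fin 3 → Poly) (x : E3) : T3 :=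
  WithLp.toLp 2 fun ij => ev x (S ij.1 ij.2)

/-- The entries of the matrix of the tangential projection, as polynomials in the base point. -/
def projEntry (a : ℝ) (i j : Fin 3) : Poly :=
  (Pi.single i 1 : Fin 3 → Poly) j - C (a ^ 2)⁻¹ * (X i * X j)

/-- The matrix product `Π S Π` of a polynomial tensor field with the tangential projection `Π`. -/
def tangentialPart (a : ℝ) (S : Fin 3 → Fin 3 → Poly) (k l : Fin 3) : Poly :=
  ∑ i, ∑ j, projEntry a i k * projEntry a l j * S i j

theorem contDiff_polyField (W : Fin 3 → Poly) {n : WithTop ℕ∞} : ContDiff ℝ n (polyField W) :=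
  contDiff_euclidean.2 fun k => contDiff_ev (W k)

theorem continuous_polyField (W : Fin 3 → Poly) : Continuous (polyField W) :=
  (contDiff_polyField W (n := 0)).continuous

theorem continuous_polyTensor (S : Fin 3 → Fin 3 → Poly) : Continuous (polyTensor S) :=
  (PiLp.continuous_toLp 2 _).comp (continuous_pi fun ij => continuous_ev (S ij.1 ij.2))

theorem fderiv_apply_coord {ι E : Type*} [Finite ι] [NormedAddCommGroup E] [NormedSpace ℝ E]
    {U : E → EuclideanSpace ℝ ι} {x : E} (hU : DifferentiableAt ℝ U x) (e : E) (k : ι) :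
    fderiv ℝ (fun y => U y k) x e = fderiv ℝ U x e k := by
  cases nonempty_fintype ι
  exact congrArg (fun T : E →L[ℝ] ℝ => T e)
    ((EuclideanSpace.proj (𝕜 := ℝ) k).hasFDerivAt.comp x hU.hasFDerivAt).fderiv

theorem fderiv_polyField_apply (W : Fin 3 → Poly) (x e : E3) (k : Fin 3) :
    fderiv ℝ (polyField W) x e k = ∑ l, e l * ev x (pderiv l (W k)) := by
  rw [← fderiv_apply_coord ((contDiff_polyField W).differentiable one_ne_zero x)]
  exact fderiv_ev (W k) x e

theorem fderiv_polyField_single (W : Fin 3 → Poly) (x : E3) (l : Fin 3) :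
    fderiv ℝ (polyField W) x (EuclideanSpace.single l 1) = polyField (fun k => pderiv l (W k)) x :=
  PiLp.ext fun k => by simp [fderiv_polyField_apply, polyField, PiLp.single_apply]

theorem fderiv_polyField_self (W : Fin 3 → Poly) (x : E3) :
    fderiv ℝ (polyField W) x x = polyField (fun k => euler (W k)) x :=
  PiLp.ext fun k => by simp [fderiv_polyField_apply, polyField, euler_apply]

theorem inner_polyField (u : E3) (W : Fin 3 → Poly) (x : E3) :
    ⟪u, polyField W x⟫ = ∑ k, u k * ev x (W k) := inner_eq_sum _ _

theorem tangentProj_apply (a : ℝ) (x v : E3) :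
    tangentProj a x v = v - (a ^ 2)⁻¹ • ⟪x, v⟫ • x := rfl

theorem ev_projEntry (a : ℝ) (x : E3) (i j : Fin 3) :
    ev x (projEntry a i j) = tangentProj a x (EuclideanSpace.single j 1) i := by
  simp [projEntry, tangentProj_apply, Pi.single_apply, PiLp.single_apply, apply_ite, eq_comm,
    mul_comm, EuclideanSpace.inner_single_right]

theorem tangentProj_apply_coord (a : ℝ) (x v : E3) (i : Fin 3) :
    tangentProj a x v i = ∑ j, ev x (projEntry a i j) * v j := by
  conv_lhs => rw [← (EuclideanSpace.basisFun (Fin 3) ℝ).sum_repr v]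
  simp [ev_projEntry, mul_comm]

theorem covDeriv_apply (a : ℝ) (U : E3 → E3) (x : E3) (i j : Fin 3) :
    covDeriv a U x (i, j) =
      tangentProj a x (fderiv ℝ U x (tangentProj a x (EuclideanSpace.single j 1))) i := rfl

theorem inner_covDeriv_polyTensor (a : ℝ) (U : E3 → E3) (S : Fin 3 → Fin 3 → Poly) (x : E3) :
    ⟪covDeriv a U x, polyTensor S x⟫ =
      ∑ k, ∑ l, ev x (tangentialPart a S k l) * fderiv ℝ U x (EuclideanSpace.single l 1) k := by
  have hcoord (i j : Fin 3) : covDeriv a U x (i, j) = ∑ k, ∑ l,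
      ev x (projEntry a i k) * (ev x (projEntry a l j) *
        fderiv ℝ U x (EuclideanSpace.single l 1) k) := by
    rw [covDeriv_apply, tangentProj_apply_coord, fderiv_eq_sum]
    simp only [ev_projEntry _ _ _ j, WithLp.ofLp_sum, Finset.sum_apply, PiLp.smul_apply,
      smul_eq_mul, Finset.mul_sum]
  rw [inner_eq_sum, Fintype.sum_prod_type]
  simp only [hcoord, polyTensor, tangentialPart, map_sum, map_mul]
  simp only [Fin.sum_univ_three]
  ring

theorem inner_tangentProj {a : ℝ} (ha : a ≠ 0) {x : E3} (hx : x ∈ sphere (0 : E3) a) (v : E3) :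
    ⟪x, tangentProj a x v⟫ = 0 := by
  rw [tangentProj_apply, inner_sub_right, real_inner_smul_right, real_inner_smul_right,
    real_inner_self_eq_norm_sq, mem_sphere_zero_iff_norm.1 hx]
  field_simp
  ring

theorem sum_X_mul_tangentialPart {a : ℝ} (ha : a ≠ 0) (S : Fin 3 → Fin 3 → Poly) (k : Fin 3)
    {x : E3} (hx : x ∈ sphere (0 : E3) a) : ev x (∑ l, X l * tangentialPart a S k l) = 0 := by
  have hproj (j : Fin 3) : ∑ l, x l * ev x (projEntry a l j) = 0 := by
    simpa only [ev_projEntry, inner_eq_sum] using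
      inner_tangentProj ha hx (EuclideanSpace.single j 1)
  have h : ev x (∑ l, X l * tangentialPart a S k l) =
      ∑ i, ∑ j, ev x (projEntry a i k) * ev x (S i j) * ∑ l, x l * ev x (projEntry a l j) := by
    simp only [tangentialPart, map_sum, map_mul, ev_X]
    simp only [Fin.sum_univ_three]
    ring
  simp only [h, hproj, mul_zero, Finset.sum_const_zero]

theorem integral_sum_mul_fderiv_apply {a : ℝ} (ha : 0 < a) {S : Fin 3 → Fin 3 → Poly}
    (hS : ∀ k, ∀ x ∈ sphere (0 : E3) a, ev x (∑ l, X l * S k l) = 0) {U : E3 → E3}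
    (hU : ContDiff ℝ 1 U) :
    ∫ x, ∑ k, ∑ l, ev x (S k l) * fderiv ℝ U x (EuclideanSpace.single l 1) k ∂(area a) =
      -∫ x, ∑ k, U x k * ev x (surfaceDiv a (S k)) ∂(area a) := by
  have hUk (k : Fin 3) : ContDiff ℝ 1 (fun y => U y k) := by fun_prop
  have hleft (k : Fin 3) : Integrable
      (fun x => ∑ l, ev x (S k l) * fderiv ℝ U x (EuclideanSpace.single l 1) k) (area a) := by
    refine integrable_area_of_continuous a (continuous_finsetSum _ fun l _ =>
      (continuous_ev _).mul ?_)
    exact (EuclideanSpace.proj (𝕜 := ℝ) k).continuous.comp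
      ((hU.continuous_fderiv one_ne_zero).clm_apply continuous_const)
  have hright (k : Fin 3) : Integrable (fun x => U x k * ev x (surfaceDiv a (S k))) (area a) :=
    integrable_area_of_continuous a ((hUk k).continuous.mul (continuous_ev _))
  rw [integral_finsetSum _ fun k _ => hleft k, integral_finsetSum _ fun k _ => hright k,
    ← Finset.sum_neg_distrib]
  refine Finset.sum_congr rfl fun k _ => ?_
  simpa only [fderiv_apply_coord (hU.differentiable one_ne_zero _)] using
    integral_sum_mul_fderiv ha (hS k) (hUk k)

theorem integral_inner_covDeriv_polyTensor {a : ℝ} (ha : 0 < a) (S : Fin 3 → Fin 3 → Poly)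
    {U : E3 → E3} (hU : ContDiff ℝ 1 U) :
    ∫ x, ⟪covDeriv a U x, polyTensor S x⟫ ∂(area a) =
      ∫ x, ⟪U x, polyField (fun k => -surfaceDiv a (tangentialPart a S k)) x⟫ ∂(area a) := by
  simp only [inner_covDeriv_polyTensor, inner_polyField, map_neg, mul_neg,
    Finset.sum_neg_distrib, integral_neg]
  exact integral_sum_mul_fderiv_apply ha
    (fun k _ hx => sum_X_mul_tangentialPart ha.ne' S k hx) hU

/-- The rotational field `x × ∇P`. -/
def rotField (P : Poly) : E3 → E3 := polyField fun k => rotDeriv k P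

theorem inner_rotField_self (P : Poly) (x : E3) : ⟪x, rotField P x⟫ = 0 := by
  simpa [rotField, inner_polyField] using congrArg (ev x) (sum_X_mul_rotDeriv P)

theorem rotField_apply (P : Poly) (x : E3) (k : Fin 3) : rotField P x k = ev x (rotDeriv k P) := rfl

theorem isSmoothField_rotField (a : ℝ) (P : Poly) : IsSmoothField a (rotField P) :=
  ⟨contDiff_polyField _, fun x _ => inner_rotField_self P x⟩

theorem covDeriv_rotField_apply (a : ℝ) (P : Poly) (x : E3) (k l : Fin 3) :
    covDeriv a (rotField P) x (k, l) = ev x (pderiv l (rotDeriv k P)) +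
      (a ^ 2)⁻¹ * (x k * ev x (rotDeriv l P) - ev x (rotDeriv k (euler P)) * x l) := by
  have hself : fderiv ℝ (rotField P) x x = rotField (euler P) x := by
    simp only [rotField, fderiv_polyField_self, euler_rotDeriv]
  have hinner : ⟪x, fderiv ℝ (rotField P) x (EuclideanSpace.single l 1)⟫ =
      -ev x (rotDeriv l P) := by
    rw [rotField, fderiv_polyField_single, inner_polyField, ← map_neg,
      ← sum_X_mul_pderiv_rotDeriv]
    simp only [map_sum, map_mul, ev_X]
  have hcoord : fderiv ℝ (rotField P) x (EuclideanSpace.single l 1) k =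
      ev x (pderiv l (rotDeriv k P)) := by
    rw [rotField, fderiv_polyField_single, polyField]
  rw [covDeriv_apply, tangentProj_apply a x (EuclideanSpace.single l 1), map_sub, map_smul,
    map_smul, hself, tangentProj_apply, inner_sub_right, real_inner_smul_right,
    real_inner_smul_right, inner_rotField_self, hinner]
  simp only [PiLp.sub_apply, PiLp.smul_apply, smul_eq_mul, hcoord, rotField_apply,
    EuclideanSpace.inner_single_right, one_mul, conj_trivial]
  ring

theorem symPart_apply (S : T3) (k l : Fin 3) : symPart S (k, l) = (S (k, l) + S (l, k)) / 2 := rfl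

theorem symPart_covDeriv_rotField (a : ℝ) (P : Poly) (x : E3) :
    symPart (covDeriv a (rotField P) x) = (2 : ℝ)⁻¹ • polyTensor (rotDeformation a P) x := by
  refine PiLp.ext fun ⟨k, l⟩ => ?_
  rw [symPart_apply, covDeriv_rotField_apply, covDeriv_rotField_apply]
  simp only [PiLp.smul_apply, smul_eq_mul, polyTensor, rotDeformation, map_add, map_mul, map_sub,
    ev_C, ev_X]
  ring

end CovariantDerivative

section SolenoidalFields

theorem polyField_add (V W : Fin 3 → Poly) (x : E3) :
    polyField (V + W) x = polyField V x + polyField W x :=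
  PiLp.ext fun _ => map_add (ev x) _ _

theorem polyField_real_smul (c : ℝ) (W : Fin 3 → Poly) (x : E3) :
    polyField (c • W) x = c • polyField W x :=
  PiLp.ext fun _ => map_smul (ev x) _ _

theorem polyField_smul (R : Poly) (W : Fin 3 → Poly) (x : E3) :
    polyField (R • W) x = ev x R • polyField W x :=
  PiLp.ext fun _ => map_mul (ev x) _ _

theorem polyField_X (x : E3) : polyField X x = x := PiLp.ext fun _ => ev_X _ _

theorem inner_polyField_single (u : E3) (i : Fin 3) (P : Poly) (x : E3) :
    ⟪u, polyField (Pi.single i P) x⟫ = u i * ev x P := by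
  simp [inner_polyField, Pi.single_apply, apply_ite]

variable {a : ℝ} {u v : E3 → E3}

theorem integrable_inner_polyField (hu : Integrable u (area a)) (W : Fin 3 → Poly) :
    Integrable (fun x => ⟪u x, polyField W x⟫) (area a) := by
  simp only [inner_polyField]
  exact integrable_finsetSum _ fun k _ =>
    ((EuclideanSpace.proj (𝕜 := ℝ) k : E3 →L[ℝ] ℝ).integrable_comp hu).mul_of_top_left
      (memLp_of_continuous a ⊤ (continuous_ev (W k)))

/-- The vector-valued distribution defined by an integrable field `u` on the sphere, as a
functional on polynomial fields. -/
def fieldFunctional (hu : Integrable u (area a)) : (Fin 3 → Poly) →ₗ[ℝ] ℝ where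
  toFun W := ∫ x, ⟪u x, polyField W x⟫ ∂(area a)
  map_add' V W := by
    simp only [polyField_add, inner_add_right]
    exact integral_add (integrable_inner_polyField hu V) (integrable_inner_polyField hu W)
  map_smul' c W := by
    simp only [polyField_real_smul, real_inner_smul_right]
    exact integral_const_mul _ _

theorem fieldFunctional_apply (hu : Integrable u (area a)) (W : Fin 3 → Poly) :
    fieldFunctional hu W = ∫ x, ⟪u x, polyField W x⟫ ∂(area a) := rfl

theorem fieldFunctional_sub (hu : Integrable u (area a)) (hv : Integrable v (area a))
    (W : Fin 3 → Poly) :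
    fieldFunctional (hu.sub hv) W = fieldFunctional hu W - fieldFunctional hv W := by
  simp only [fieldFunctional_apply, Pi.sub_apply, inner_sub_left]
  exact integral_sub (integrable_inner_polyField hu W) (integrable_inner_polyField hv W)

theorem fieldFunctional_normSq_smul (ha : 0 < a) (hu : Integrable u (area a))
    (W : Fin 3 → Poly) :
    fieldFunctional hu ((normSq : Poly) • W) = a ^ 2 * fieldFunctional hu W := by
  rw [fieldFunctional_apply, fieldFunctional_apply, ← integral_const_mul]
  refine integral_congr_ae ?_
  filter_upwards [ae_mem_sphere_of_pos ha] with x hx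
  rw [polyField_smul, ev_normSq_of_mem_sphere hx, real_inner_smul_right]

theorem fieldFunctional_smul_X (hu : Integrable u (area a))
    (htan : ∀ᵐ x ∂(area a), ⟪x, u x⟫ = 0) (R : Poly) : fieldFunctional hu (R • X) = 0 := by
  refine integral_eq_zero_of_ae ?_
  filter_upwards [htan] with x hx
  rw [polyField_smul, polyField_X, real_inner_smul_right, real_inner_comm, hx, mul_zero,
    Pi.zero_apply]

/-- The gradient `∇P`. -/
def polyGrad : Poly →ₗ[ℝ] (Fin 3 → Poly) := LinearMap.pi fun k => (pderiv k).toLinearMap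

/-- The rotational field `x × ∇P`, as a triple of polynomials. -/
def polyRot : Poly →ₗ[ℝ] (Fin 3 → Poly) := LinearMap.pi fun k => (rotDeriv k).toLinearMap

theorem polyGrad_apply (P : Poly) (k : Fin 3) : polyGrad P k = pderiv k P := rfl

theorem polyRot_apply (P : Poly) (k : Fin 3) : polyRot P k = rotDeriv k P := rfl

theorem polyRot_normSq_mul (P : Poly) : polyRot (normSq * P) = (normSq : Poly) • polyRot P :=
  funext fun k => rotDeriv_normSq_mul k P

theorem polyRot_C (c : ℝ) : polyRot (C c) = 0 :=
  funext fun k => (rotDeriv k).map_algebraMap c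

theorem inner_polyField_polyGrad (u : E3) (P : Poly) (x : E3) :
    ⟪u, polyField (polyGrad P) x⟫ = fderiv ℝ (fun y => ev y P) x u := by
  simp only [inner_polyField, fderiv_ev, polyGrad_apply]

/-- Integrable tangential fields on the sphere that are divergence free in the sense of
distributions. -/
structure IsSolenoidal (a : ℝ) (u : E3 → E3) : Prop where
  integrable : Integrable u (area a)
  tangent : ∀ᵐ x ∂(area a), ⟪x, u x⟫ = 0
  divFree : ∀ P : Poly, ∫ x, ⟪u x, polyField (polyGrad P) x⟫ ∂(area a) = 0

theorem IsSolenoidal.sub (hu : IsSolenoidal a u) (hv : IsSolenoidal a v) :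
    IsSolenoidal a (u - v) where
  integrable := hu.integrable.sub hv.integrable
  tangent := by
    filter_upwards [hu.tangent, hv.tangent] with x hux hvx
    rw [Pi.sub_apply, inner_sub_right, hux, hvx, sub_zero]
  divFree P := by
    rw [← fieldFunctional_apply (hu.integrable.sub hv.integrable),
      fieldFunctional_sub hu.integrable hv.integrable, fieldFunctional_apply,
      fieldFunctional_apply, hu.divFree, hv.divFree, sub_zero]

theorem surfaceDiv_rotDeriv (a : ℝ) (Q : Poly) : surfaceDiv a (fun k => rotDeriv k Q) = 0 := by
  simp only [surfaceDiv, sum_pderiv_rotDeriv, euler_rotDeriv, sum_X_mul_rotDeriv, mul_zero,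
    sub_zero]

theorem integral_fderiv_rotField (ha : 0 < a) (Q : Poly) {f : E3 → ℝ} (hf : ContDiff ℝ 1 f) :
    ∫ x, fderiv ℝ f x (rotField Q x) ∂(area a) = 0 := by
  have h := integral_sum_mul_fderiv ha (W := fun k => rotDeriv k Q)
    (fun x _ => by rw [sum_X_mul_rotDeriv, map_zero]) hf
  simpa only [fderiv_eq_sum f _ (rotField Q _), rotField_apply, smul_eq_mul, surfaceDiv_rotDeriv,
    map_zero, mul_zero, integral_zero, neg_zero] using h

theorem isSolenoidal_rotField (ha : 0 < a) (Q : Poly) : IsSolenoidal a (rotField Q) where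
  integrable := memLp_one_iff_integrable.1 (memLp_of_continuous a 1 (continuous_polyField _))
  tangent := .of_forall fun x => inner_rotField_self Q x
  divFree P := by
    simpa only [inner_polyField_polyGrad] using integral_fderiv_rotField ha Q (contDiff_ev P)

theorem polyGrad_C_mul_X (c : ℝ) (i : Fin 3) : polyGrad (C c * X i) = Pi.single i (C c) := by
  funext k
  simp [polyGrad_apply, Pi.single_apply, MvPolynomial.pderiv_X, Derivation.leibniz, eq_comm]

/-- The tangential part of `Δ_M(P) e_i` is a gradient plus the rotational field of `(x × ∇)_i P`. -/
theorem single_sphLaplacian (i : Fin 3) (P : Poly) :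
    (Pi.single i (sphLaplacian P) : Fin 3 → Poly) =
      polyGrad (normSq * pderiv i P - X i * euler P) + polyRot (rotDeriv i P) +
        (X i * laplacian P - euler (pderiv i P) - 2 * pderiv i P) • X := by
  funext k
  simp only [Pi.add_apply, polyGrad_apply, polyRot_apply, Pi.smul_apply, smul_eq_mul]
  fin_cases i <;> fin_cases k <;>
    simp only [sphLaplacian_apply, laplacian_apply, euler_apply, normSq, Fin.sum_univ_three,
      rotDeriv_zero, rotDeriv_one, rotDeriv_two, map_add, map_sub, Derivation.leibniz, smul_eq_mul,
      MvPolynomial.pderiv_X, Pi.single_apply, pderiv_comm (1 : Fin 3) 0, pderiv_comm (2 : Fin 3) 0,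
      pderiv_comm (2 : Fin 3) 1, Fin.isValue, Fin.zero_eta, Fin.mk_one, Fin.reduceFinMk,
      Fin.reduceEq, ↓reduceIte] <;>
    ring

theorem IsSolenoidal.fieldFunctional_single_sphLaplacian (hu : IsSolenoidal a u) (i : Fin 3)
    (P : Poly) :
    fieldFunctional hu.integrable (Pi.single i (sphLaplacian P)) =
      fieldFunctional hu.integrable (polyRot (rotDeriv i P)) := by
  rw [single_sphLaplacian, map_add, map_add, fieldFunctional_apply _ (polyGrad _), hu.divFree,
    fieldFunctional_smul_X hu.integrable hu.tangent, zero_add, add_zero]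

theorem IsSolenoidal.fieldFunctional_single_C (hu : IsSolenoidal a u) (i : Fin 3) (c : ℝ) :
    fieldFunctional hu.integrable (Pi.single i (C c)) = 0 := by
  rw [← polyGrad_C_mul_X, fieldFunctional_apply, hu.divFree]

theorem IsSolenoidal.ae_eq_zero (ha : 0 < a) (hu : IsSolenoidal a u)
    (h : ∀ P, fieldFunctional hu.integrable (polyRot P) = 0) : u =ᵐ[area a] 0 := by
  have hcoord (i : Fin 3) : ∀ᵐ x ∂(area a), u x i = 0 := by
    refine ae_eq_zero_of_forall_integral_mul_ev_eq_zero (isCompact_sphere 0 |a|) ae_mem_sphere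
      ((EuclideanSpace.proj (𝕜 := ℝ) i : E3 →L[ℝ] ℝ).integrable_comp hu.integrable) fun P => ?_
    have hℓ : fieldFunctional hu.integrable ∘ₗ LinearMap.single ℝ (fun _ => Poly) i = 0 := by
      refine eq_zero_of_comp_sphLaplacian_eq_zero (a := a) (fun P => ?_)
        (hu.fieldFunctional_single_C i)
        fun P => (hu.fieldFunctional_single_sphLaplacian i P).trans (h _)
      rw [LinearMap.comp_apply, LinearMap.comp_apply, LinearMap.single_apply,
        LinearMap.single_apply, ← smul_eq_mul, Pi.single_smul, fieldFunctional_normSq_smul ha]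
    simpa only [LinearMap.comp_apply, LinearMap.single_apply, fieldFunctional_apply,
      inner_polyField_single, LinearMap.zero_apply] using congrArg (· P) hℓ
  filter_upwards [ae_all_iff.2 hcoord] with x hx
  exact PiLp.ext hx

theorem integrable_ev (a : ℝ) (P : Poly) : Integrable (fun x => ev x P) (area a) :=
  integrable_area_of_continuous a (continuous_ev P)

/-- The integral of a polynomial over the sphere. -/
def sphereIntegral (a : ℝ) : Poly →ₗ[ℝ] ℝ where
  toFun P := ∫ x, ev x P ∂(area a)
  map_add' P Q := by
    simp only [map_add]
    exact integral_add (integrable_ev a P) (integrable_ev a Q)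
  map_smul' c P := by
    simp only [map_smul, RingHom.id_apply]
    exact integral_smul c _

theorem sphereIntegral_apply (a : ℝ) (P : Poly) :
    sphereIntegral a P = ∫ x, ev x P ∂(area a) := rfl

theorem sphereIntegral_mul_rotDeriv (a : ℝ) (m : Fin 3) (P Q : Poly) :
    sphereIntegral a (P * rotDeriv m Q) = -sphereIntegral a (rotDeriv m P * Q) := by
  have h : sphereIntegral a (rotDeriv m (P * Q)) = 0 := integral_rotDeriv a m (P * Q)
  rw [Derivation.leibniz, smul_eq_mul, smul_eq_mul, map_add, mul_comm Q] at h
  linarith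

theorem sphereIntegral_mul_sphLaplacian (a : ℝ) (P Q : Poly) :
    sphereIntegral a (P * sphLaplacian Q) = sphereIntegral a (sphLaplacian P * Q) := by
  simp only [sphLaplacian_apply, Finset.mul_sum, Finset.sum_mul, map_sum,
    sphereIntegral_mul_rotDeriv, neg_neg]

theorem eq_zero_of_sphereIntegral_mul_self_eq_zero (ha : 0 < a) {n : ℕ} {P : Poly}
    (hP : P.IsHomogeneous n) (h : sphereIntegral a (P * P) = 0) : P = 0 :=
  eq_zero_of_integral_ev_mul_self_eq_zero ha hP (by
    simpa only [sphereIntegral_apply, map_mul] using h)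

/-- Riesz representation on the finite-dimensional space of homogeneous polynomials of degree `n`,
with the scalar product of `L²` of the sphere. -/
theorem exists_sphereIntegral_mul_eq (ha : 0 < a) (n : ℕ) (ℓ : Poly →ₗ[ℝ] ℝ) :
    ∃ Q : Poly, Q.IsHomogeneous n ∧
      ∀ P : Poly, P.IsHomogeneous n → sphereIntegral a (Q * P) = ℓ P := by
  let V := MvPolynomial.homogeneousSubmodule (Fin 3) ℝ n
  have : Module.Finite ℝ V :=
    Module.Finite.iff_fg.2 (MvPolynomial.homogeneousSubmodule_fg (Fin 3) ℝ n)
  let T : V →ₗ[ℝ] Module.Dual ℝ V :=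
    ((LinearMap.mul ℝ Poly).compr₂ (sphereIntegral a)).domRestrict₁₂ V V
  have hT : Function.Injective T := (injective_iff_map_eq_zero T).2 fun Q hQ =>
    Subtype.ext (eq_zero_of_sphereIntegral_mul_self_eq_zero ha Q.2 (congrArg (· Q) hQ))
  obtain ⟨Q, hQ⟩ := (LinearMap.injective_iff_surjective_of_finrank_eq_finrank
    Subspace.dual_finrank_eq.symm).1 hT (ℓ ∘ₗ V.subtype)
  exact ⟨Q, Q.2, fun P hP => congrArg (· ⟨P, hP⟩) hQ⟩

theorem fieldFunctional_rotField_polyRot (Q : Poly) (h : Integrable (rotField Q) (area a))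
    (P : Poly) :
    fieldFunctional h (polyRot P) = -sphereIntegral a (sphLaplacian Q * P) := by
  have hinner (x : E3) :
      ⟪rotField Q x, polyField (polyRot P) x⟫ = ev x (∑ m, rotDeriv m Q * rotDeriv m P) := by
    simp only [inner_polyField, map_sum, map_mul, rotField_apply, polyRot_apply]
  rw [fieldFunctional_apply]
  simp only [hinner]
  rw [← sphereIntegral_apply, map_sum, sphLaplacian_apply, Finset.sum_mul, map_sum,
    ← Finset.sum_neg_distrib]
  exact Finset.sum_congr rfl fun m _ => sphereIntegral_mul_rotDeriv a m _ P

theorem sphLaplacian_of_isHomogeneous_one {Q : Poly} (hQ : Q.IsHomogeneous 1) :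
    sphLaplacian Q = -((2 : ℝ) • Q) := by
  rw [sphLaplacian_of_isHomogeneous hQ, laplacian_of_isHomogeneous_one hQ]
  norm_num

theorem fieldFunctional_rotField_polyRot_of_isHomogeneous_one {Q : Poly} (hQ : Q.IsHomogeneous 1)
    (h : Integrable (rotField Q) (area a)) (P : Poly) :
    fieldFunctional h (polyRot P) = 2 * sphereIntegral a (Q * P) := by
  rw [fieldFunctional_rotField_polyRot, sphLaplacian_of_isHomogeneous_one hQ, neg_mul, map_neg,
    neg_neg, smul_mul_assoc, map_smul, smul_eq_mul]

theorem sphereIntegral_mul_stokes_add_coriolis {c : ℝ} {m : Fin 3} {Q : Poly}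
    (hQ : Q.IsHomogeneous 1) (hc : c • rotDeriv m Q = 0) (P : Poly) :
    sphereIntegral a
      (Q * (sphLaplacian (sphLaplacian P) + (2 : ℝ) • sphLaplacian P + c • rotDeriv m P)) = 0 := by
  have hcP : c * sphereIntegral a (rotDeriv m Q * P) = 0 := by
    rw [← smul_eq_mul, ← map_smul, ← smul_mul_assoc, hc, zero_mul, map_zero]
  simp only [mul_add, mul_smul_comm, map_add, map_smul, sphereIntegral_mul_rotDeriv,
    sphereIntegral_mul_sphLaplacian, sphLaplacian_of_isHomogeneous_one hQ, neg_mul, smul_mul_assoc,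
    map_neg, smul_eq_mul]
  linear_combination -hcP

theorem smul_rotDeriv_eq_zero {c : ℝ} {m : Fin 3} (ha : 0 < a) {Q : Poly} (hQ : Q.IsHomogeneous 1)
    (h : ∀ P : Poly, P.IsHomogeneous 1 → c * sphereIntegral a (Q * rotDeriv m P) = 0) :
    c • rotDeriv m Q = 0 := by
  have hmQ := isHomogeneous_rotDeriv hQ m
  rcases mul_eq_zero.1 (h _ hmQ) with hc | hint
  · rw [hc, zero_smul]
  · rw [sphereIntegral_mul_rotDeriv, neg_eq_zero] at hint
    rw [eq_zero_of_sphereIntegral_mul_self_eq_zero ha hmQ hint, smul_zero]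

theorem IsSolenoidal.exists_ae_eq_rotField {c : ℝ} {m : Fin 3} (ha : 0 < a)
    (hu : IsSolenoidal a u)
    (h : ∀ P, fieldFunctional hu.integrable (polyRot
      (sphLaplacian (sphLaplacian P) + (2 : ℝ) • sphLaplacian P + c • rotDeriv m P)) = 0) :
    ∃ Q : Poly, Q.IsHomogeneous 1 ∧ c • rotDeriv m Q = 0 ∧ u =ᵐ[area a] rotField Q := by
  obtain ⟨Q, hQ, hQu⟩ := exists_sphereIntegral_mul_eq ha 1
    ((2 : ℝ)⁻¹ • fieldFunctional hu.integrable ∘ₗ polyRot)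
  replace hQu (P : Poly) (hP : P.IsHomogeneous 1) :
      fieldFunctional hu.integrable (polyRot P) = 2 * sphereIntegral a (Q * P) := by
    simp [hQu P hP]
  have hcQ : c • rotDeriv m Q = 0 := by
    refine smul_rotDeriv_eq_zero ha hQ fun P hP => ?_
    have hmP : (c • rotDeriv m P).IsHomogeneous 1 :=
      (MvPolynomial.homogeneousSubmodule (Fin 3) ℝ 1).smul_mem c (isHomogeneous_rotDeriv hP m)
    have hstokes : sphLaplacian (sphLaplacian P) + (2 : ℝ) • sphLaplacian P = 0 := by
      rw [sphLaplacian_of_isHomogeneous_one hP, map_neg, map_smul,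
        sphLaplacian_of_isHomogeneous_one hP, smul_neg, neg_neg, add_neg_cancel]
    have hℓ := h P
    rw [hstokes, zero_add, hQu _ hmP, mul_smul_comm, map_smul, smul_eq_mul] at hℓ
    linarith
  have hrot := isSolenoidal_rotField ha Q
  have hdiff (P : Poly) : fieldFunctional (hu.sub hrot).integrable (polyRot P) =
      fieldFunctional hu.integrable (polyRot P) - 2 * sphereIntegral a (Q * P) := by
    rw [fieldFunctional_sub hu.integrable hrot.integrable,
      fieldFunctional_rotField_polyRot_of_isHomogeneous_one hQ]
  have hzero : fieldFunctional (hu.sub hrot).integrable ∘ₗ polyRot = 0 := by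
    refine eq_zero_of_comp_stokes_add_coriolis_eq_zero (a := a) (c := c) (m := m)
      (fun P => ?_) (fun c => ?_) (fun P hP => ?_) fun P => ?_
    · rw [LinearMap.comp_apply, polyRot_normSq_mul, fieldFunctional_normSq_smul ha,
        LinearMap.comp_apply]
    · rw [LinearMap.comp_apply, polyRot_C, map_zero]
    · rw [LinearMap.comp_apply, hdiff, hQu P hP, sub_self]
    · rw [LinearMap.comp_apply, hdiff, h, sphereIntegral_mul_stokes_add_coriolis hQ hcQ, mul_zero,
        sub_zero]
  refine ⟨Q, hQ, hcQ, ?_⟩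
  filter_upwards [(hu.sub hrot).ae_eq_zero ha fun P => congrArg (· P) hzero] with x hx
  exact sub_eq_zero.1 hx

end SolenoidalFields

section TangentialTensors

variable {a : ℝ}

theorem tangentProj_of_inner_eq_zero {x v : E3} (h : ⟪x, v⟫ = 0) : tangentProj a x v = v := by
  rw [tangentProj_apply, h, zero_smul, smul_zero, sub_zero]

theorem sum_ev_projEntry_mul {x : E3} {v : Fin 3 → ℝ} (h : ∑ j, x j * v j = 0) (i : Fin 3) :
    ∑ j, ev x (projEntry a i j) * v j = v i := by
  rw [← tangentProj_apply_coord a x (WithLp.toLp 2 v), tangentProj_of_inner_eq_zero]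
  rwa [inner_eq_sum]

theorem projEntry_comm (i j : Fin 3) : projEntry a i j = projEntry a j i := by
  simp only [projEntry, Pi.single_apply, eq_comm (a := i), mul_comm (X i)]

theorem ev_tangentialPart_of_tangential {S : Fin 3 → Fin 3 → Poly} {x : E3}
    (hrow : ∀ k, ∑ l, x l * ev x (S k l) = 0) (hcol : ∀ l, ∑ k, x k * ev x (S k l) = 0)
    (k l : Fin 3) : ev x (tangentialPart a S k l) = ev x (S k l) := by
  simp only [tangentialPart, map_sum, map_mul, mul_assoc, ← Finset.mul_sum,
    sum_ev_projEntry_mul (hrow _), projEntry_comm _ k, sum_ev_projEntry_mul (hcol l)]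

theorem integral_inner_covDeriv_polyTensor_of_tangential (ha : 0 < a) {S : Fin 3 → Fin 3 → Poly}
    (hS : ∀ k, ∀ x ∈ sphere (0 : E3) a, ev x (∑ l, X l * S k l) = 0)
    (hsymm : ∀ k l, S k l = S l k) {U : E3 → E3} (hU : ContDiff ℝ 1 U) :
    ∫ x, ⟪covDeriv a U x, polyTensor S x⟫ ∂(area a) =
      ∫ x, ⟪U x, polyField (fun k => -surfaceDiv a (S k)) x⟫ ∂(area a) := by
  simp only [inner_polyField, map_neg, mul_neg, Finset.sum_neg_distrib, integral_neg]
  rw [← integral_sum_mul_fderiv_apply ha hS hU]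
  refine integral_congr_ae ?_
  filter_upwards [ae_mem_sphere_of_pos ha] with x hx
  have hrow (k : Fin 3) : ∑ l, x l * ev x (S k l) = 0 := by
    simpa only [map_sum, map_mul, ev_X] using hS k x hx
  simp only [inner_covDeriv_polyTensor, ev_tangentialPart_of_tangential hrow
    (fun l => by simpa only [hsymm l] using hrow l)]

theorem ev_sum_X_mul_rotDeformation (ha : a ≠ 0) {x : E3} (hx : x ∈ sphere (0 : E3) a) (P : Poly)
    (k : Fin 3) : ev x (∑ l, X l * rotDeformation a P k l) = 0 := by
  rw [sum_X_mul_rotDeformation, map_mul, map_sub, map_mul, ev_C, ev_normSq_of_mem_sphere hx,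
    map_one, inv_mul_cancel₀ (pow_ne_zero 2 ha), sub_self, zero_mul]

theorem rotDeformation_comm (P : Poly) (k l : Fin 3) :
    rotDeformation a P k l = rotDeformation a P l k := by
  rw [rotDeformation, rotDeformation]
  ring

theorem inner_symPart_symPart (S T : T3) : ⟪symPart S, symPart T⟫ = ⟪S, symPart T⟫ := by
  simp only [inner_eq_sum, Fintype.sum_prod_type, symPart_apply, Fin.sum_univ_three]
  ring

theorem integral_inner_covDeriv_rotDeformation (ha : 0 < a) (P : Poly) {U : E3 → E3}
    (hU : ContDiff ℝ 1 U) :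
    ∫ x, ⟪covDeriv a U x, polyTensor (rotDeformation a P) x⟫ ∂(area a) =
      ∫ x, ⟪U x, -((a ^ 2)⁻¹ • rotField (sphLaplacian P + (2 : ℝ) • P) x)⟫ ∂(area a) := by
  rw [integral_inner_covDeriv_polyTensor_of_tangential ha
    (fun k x hx => ev_sum_X_mul_rotDeformation ha.ne' hx P k) (rotDeformation_comm P) hU]
  refine integral_congr_ae ?_
  filter_upwards [ae_mem_sphere_of_pos ha] with x hx
  congr 1
  refine PiLp.ext fun k => ?_
  simp only [polyField, map_neg, ev_surfaceDiv_rotDeformation ha.ne' hx, PiLp.neg_apply,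
    PiLp.smul_apply, smul_eq_mul, rotField_apply]

end TangentialTensors

section SobolevFields

theorem lpPairing_innerSL_congr {α F : Type*} [MeasurableSpace α] {μ : Measure α}
    [NormedAddCommGroup F] [InnerProductSpace ℝ F] {q q' : ℝ≥0∞} [Fact (1 ≤ q)] [Fact (1 ≤ q')]
    [q.HolderConjugate q'] {u : Lp F q μ} {v : Lp F q' μ} {U V : α → F} (hu : u =ᵐ[μ] U)
    (hv : v =ᵐ[μ] V) : (innerSL ℝ).lpPairing μ q q' u v = ∫ x, ⟪U x, V x⟫ ∂μ := by
  rw [ContinuousLinearMap.lpPairing_eq_integral]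
  refine integral_congr_ae ?_
  filter_upwards [hu, hv] with x hux hvx
  rw [hux, hvx, innerSL_apply_apply]

theorem integrable_coeFn {α F : Type*} [MeasurableSpace α] {μ : Measure α}
    [IsFiniteMeasure μ] [NormedAddCommGroup F] {q : ℝ≥0∞} [Fact (1 ≤ q)] (u : Lp F q μ) :
    Integrable u μ :=
  (Lp.memLp u).integrable Fact.out

/-- The class of a continuous function in `L_q` of the sphere. -/
def contLp {F : Type*} [NormedAddCommGroup F] [SecondCountableTopologyEither E3 F] (a : ℝ)
    (q : ℝ≥0∞) {f : E3 → F} (hf : Continuous f) : Lp F q (area a) :=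
  (memLp_of_continuous a q hf).toLp f

theorem coeFn_contLp {F : Type*} [NormedAddCommGroup F] [SecondCountableTopologyEither E3 F]
    (a : ℝ) (q : ℝ≥0∞) {f : E3 → F} (hf : Continuous f) : contLp a q hf =ᵐ[area a] f :=
  MemLp.coeFn_toLp _

/-- The field `x × ∇P` with its covariant derivative. -/
def rotPair (a : ℝ) (q : ℝ≥0∞) (P : Poly) : Lp E3 q (area a) × Lp T3 q (area a) :=
  (contLp a q (isSmoothField_rotField a P).smooth.continuous,
    contLp a q (continuous_covDeriv a (isSmoothField_rotField a P).smooth))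

theorem coeFn_rotPair_fst (a : ℝ) (q : ℝ≥0∞) (P : Poly) :
    (rotPair a q P).1 =ᵐ[area a] rotField P :=
  coeFn_contLp a q (isSmoothField_rotField a P).smooth.continuous

theorem coeFn_rotPair_snd (a : ℝ) (q : ℝ≥0∞) (P : Poly) :
    (rotPair a q P).2 =ᵐ[area a] covDeriv a (rotField P) :=
  coeFn_contLp a q (continuous_covDeriv a (isSmoothField_rotField a P).smooth)

variable {a : ℝ} {q : ℝ≥0∞} [Fact (1 ≤ q)] {p : Lp E3 q (area a) × Lp T3 q (area a)}

theorem integral_inner_snd_of_mem_H1 {S : E3 → T3} {W : E3 → E3} (hS : Continuous S)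
    (hW : Continuous W)
    (h : ∀ U, IsSmoothField a U →
      ∫ x, ⟪covDeriv a U x, S x⟫ ∂(area a) = ∫ x, ⟪U x, W x⟫ ∂(area a))
    (hp : p ∈ H1 a q) :
    ∫ x, ⟪p.2 x, S x⟫ ∂(area a) = ∫ x, ⟪p.1 x, W x⟫ ∂(area a) := by
  let q' := q.conjExponent
  have : Fact (1 ≤ q') := ⟨le_self_add⟩
  let Λ₂ : Lp E3 q (area a) × Lp T3 q (area a) →L[ℝ] ℝ :=
    (tensorPairing a q q').flip (contLp a q' hS) ∘L ContinuousLinearMap.snd ℝ _ _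
  let Λ₁ : Lp E3 q (area a) × Lp T3 q (area a) →L[ℝ] ℝ :=
    (fieldPairing a q q').flip (contLp a q' hW) ∘L ContinuousLinearMap.fst ℝ _ _
  have hΛ₂ (r : Lp E3 q (area a) × Lp T3 q (area a)) {T : E3 → T3} (hT : r.2 =ᵐ[area a] T) :
      Λ₂ r = ∫ x, ⟪T x, S x⟫ ∂(area a) := lpPairing_innerSL_congr hT (coeFn_contLp a q' hS)
  have hΛ₁ (r : Lp E3 q (area a) × Lp T3 q (area a)) {U : E3 → E3} (hU : r.1 =ᵐ[area a] U) :
      Λ₁ r = ∫ x, ⟪U x, W x⟫ ∂(area a) := lpPairing_innerSL_congr hU (coeFn_contLp a q' hW)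
  have hle : H1 a q ≤ (Λ₂ - Λ₁).ker :=
    Submodule.topologicalClosure_minimal _ (fun r ⟨U, hU, hr₁, hr₂⟩ => sub_eq_zero.2
      ((hΛ₂ r hr₂).trans ((h U hU).trans (hΛ₁ r hr₁).symm))) (Λ₂ - Λ₁).isClosed_ker
  rw [← hΛ₂ p .rfl, ← hΛ₁ p .rfl]
  exact sub_eq_zero.1 (hle hp)

theorem ae_tangent_of_mem_H1 (ha : 0 < a) (hp : p ∈ H1 a q) :
    ∀ᵐ x ∂(area a), ⟪x, p.1 x⟫ = 0 := by
  have hinner (x : E3) : ⟪x, p.1 x⟫ = ⟪p.1 x, polyField X x⟫ := by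
    rw [polyField_X, real_inner_comm]
  simp only [hinner]
  refine ae_eq_zero_of_forall_integral_mul_ev_eq_zero (isCompact_sphere 0 |a|) ae_mem_sphere
    (integrable_inner_polyField (integrable_coeFn p.1) X) fun P => ?_
  have h := integral_inner_snd_of_mem_H1 (S := 0) continuous_zero
    (continuous_polyField (P • X)) (fun U hU => ?_) hp
  · simpa only [polyField_smul, real_inner_smul_right, Pi.zero_apply, inner_zero_right,
      integral_zero, mul_comm] using h.symm
  · refine integral_congr_ae ?_
    filter_upwards [ae_mem_sphere_of_pos ha] with x hx
    rw [polyField_smul, polyField_X, real_inner_smul_right, real_inner_comm x (U x),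
      hU.tangent x hx, mul_zero, Pi.zero_apply, inner_zero_right]

theorem ae_eq_zero_of_forall_integral_inner_polyTensor {T : E3 → T3} (hT : Integrable T (area a))
    (h : ∀ S, ∫ x, ⟪T x, polyTensor S x⟫ ∂(area a) = 0) : T =ᵐ[area a] 0 := by
  have hcoord (ij : Fin 3 × Fin 3) : ∀ᵐ x ∂(area a), T x ij = 0 := by
    refine ae_eq_zero_of_forall_integral_mul_ev_eq_zero (isCompact_sphere 0 |a|) ae_mem_sphere
      ((EuclideanSpace.proj (𝕜 := ℝ) ij : T3 →L[ℝ] ℝ).integrable_comp hT) fun P => ?_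
    have hinner (x : E3) :
        ⟪T x, polyTensor (fun k l => if (k, l) = ij then P else 0) x⟫ = T x ij * ev x P := by
      simp [inner_eq_sum, polyTensor, apply_ite (ev x)]
    simpa only [hinner] using h fun k l => if (k, l) = ij then P else 0
  filter_upwards [ae_all_iff.2 hcoord] with x hx
  exact PiLp.ext hx

theorem snd_eq_zero_of_mem_H1 (ha : 0 < a) (hp : p ∈ H1 a q) (h0 : p.1 = 0) : p.2 = 0 := by
  refine (Lp.eq_zero_iff_ae_eq_zero).2 <|
    ae_eq_zero_of_forall_integral_inner_polyTensor (integrable_coeFn p.2) fun S => ?_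
  rw [integral_inner_snd_of_mem_H1 (continuous_polyTensor S) (continuous_polyField _)
    (fun U hU => integral_inner_covDeriv_polyTensor ha S (hU.smooth.of_le (by simp))) hp]
  refine integral_eq_zero_of_ae ?_
  filter_upwards [(Lp.eq_zero_iff_ae_eq_zero).1 h0] with x hx
  rw [hx, Pi.zero_apply, Pi.zero_apply, inner_zero_left]

theorem rotPair_mem_H1 (P : Poly) : rotPair a q P ∈ H1 a q :=
  Submodule.le_topologicalClosure _ ⟨rotField P, isSmoothField_rotField a P,
    coeFn_rotPair_fst a q P, coeFn_rotPair_snd a q P⟩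

theorem eq_rotPair_of_ae_eq (ha : 0 < a) (hp : p ∈ H1 a q) {P : Poly}
    (h : p.1 =ᵐ[area a] rotField P) : p = rotPair a q P := by
  have hfst : (p - rotPair a q P).1 = 0 :=
    sub_eq_zero.2 (Lp.ext (h.trans (coeFn_rotPair_fst a q P).symm))
  exact sub_eq_zero.1 (Prod.ext hfst
    (snd_eq_zero_of_mem_H1 ha (Submodule.sub_mem _ hp (rotPair_mem_H1 P)) hfst))

theorem integral_inner_rotDeformation_of_mem_H1 (ha : 0 < a) (hp : p ∈ H1 a q) (P : Poly) :
    ∫ x, ⟪p.2 x, polyTensor (rotDeformation a P) x⟫ ∂(area a) =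
      -(a ^ 2)⁻¹ * fieldFunctional (integrable_coeFn p.1)
        (polyRot (sphLaplacian P + (2 : ℝ) • P)) := by
  rw [integral_inner_snd_of_mem_H1 (continuous_polyTensor _)
    ((continuous_polyField _).const_smul (a ^ 2)⁻¹).neg
    (fun U hU => integral_inner_covDeriv_rotDeformation ha P (hU.smooth.of_le (by simp))) hp]
  simp only [Pi.neg_apply, Pi.smul_apply, inner_neg_right, real_inner_smul_right, integral_neg,
    integral_const_mul, neg_mul]
  rfl

variable {q' : ℝ≥0∞} [Fact (1 ≤ q')] [q.HolderConjugate q']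

theorem tensorPairing_symPart_rotPair (ha : 0 < a) (hp : p ∈ H1 a q) (P : Poly) :
    tensorPairing a q q' (symPart.compLpL q (area a) p.2)
        (symPart.compLpL q' (area a) (rotPair a q' P).2) =
      -(2 * a ^ 2)⁻¹ * fieldFunctional (integrable_coeFn p.1)
        (polyRot (sphLaplacian P + (2 : ℝ) • P)) := by
  have hD : symPart.compLpL q' (area a) (rotPair a q' P).2 =ᵐ[area a]
      fun x => symPart (covDeriv a (rotField P) x) := by
    filter_upwards [symPart.coeFn_compLpL (rotPair a q' P).2, coeFn_rotPair_snd a q' P]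
      with x hx hPx
    rw [hx, hPx]
  rw [tensorPairing, lpPairing_innerSL_congr (symPart.coeFn_compLpL p.2) hD]
  simp only [inner_symPart_symPart]
  simp only [symPart_covDeriv_rotField, real_inner_smul_right, integral_const_mul]
  rw [integral_inner_rotDeformation_of_mem_H1 ha hp]
  ring

end SobolevFields

section HelmholtzDecomposition

theorem continuous_surfaceGrad (a : ℝ) {Φ : E3 → ℝ} (hΦ : ContDiff ℝ 1 Φ) :
    Continuous (surfaceGrad a Φ) :=
  (continuous_tangentProj a).clm_apply
    ((InnerProductSpace.toDual ℝ E3).symm.continuous.comp (hΦ.continuous_fderiv one_ne_zero))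

theorem gradient_ev (P : Poly) (x : E3) :
    gradient (fun y => ev y P) x = polyField (polyGrad P) x :=
  ext_inner_left ℝ fun v => by
    rw [inner_polyField_polyGrad, real_inner_comm, gradient, InnerProductSpace.toDual_symm_apply]

theorem surfaceGrad_ev (a : ℝ) (P : Poly) (x : E3) :
    surfaceGrad a (fun y => ev y P) x = tangentProj a x (polyField (polyGrad P) x) := by
  rw [surfaceGrad, gradient_ev]

theorem inner_surfaceGrad (a : ℝ) (Φ : E3 → ℝ) {x v : E3} (h : ⟪x, v⟫ = 0) :
    ⟪v, surfaceGrad a Φ x⟫ = fderiv ℝ Φ x v := by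
  rw [surfaceGrad, tangentProj_apply, inner_sub_right, real_inner_smul_right,
    real_inner_smul_right, real_inner_comm x v, h, mul_zero, mul_zero, sub_zero, real_inner_comm,
    gradient, InnerProductSpace.toDual_symm_apply]

/-- A polynomial with its surface gradient. -/
def scalarPair (a : ℝ) (q : ℝ≥0∞) (P : Poly) : Lp ℝ q (area a) × Lp E3 q (area a) :=
  (contLp a q (continuous_ev P), contLp a q (continuous_surfaceGrad a (contDiff_ev P)))

theorem coeFn_scalarPair_snd (a : ℝ) (q : ℝ≥0∞) (P : Poly) :
    (scalarPair a q P).2 =ᵐ[area a] surfaceGrad a fun x => ev x P :=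
  coeFn_contLp a q (continuous_surfaceGrad a (contDiff_ev P))

variable {a : ℝ} {q q' : ℝ≥0∞} [Fact (1 ≤ q)] [Fact (1 ≤ q')] [q.HolderConjugate q']

theorem scalarPair_mem_H1Scalar (P : Poly) : scalarPair a q P ∈ H1Scalar a q :=
  Submodule.le_topologicalClosure _ ⟨fun x => ev x P, contDiff_ev P,
    coeFn_contLp a q (continuous_ev P), coeFn_scalarPair_snd a q P⟩

theorem fieldPairing_comm (u : Lp E3 q (area a)) (v : Lp E3 q' (area a)) :
    fieldPairing a q q' u v = fieldPairing a q' q v u := by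
  rw [fieldPairing, fieldPairing, lpPairing_innerSL_congr .rfl .rfl,
    lpPairing_innerSL_congr .rfl .rfl]
  exact integral_congr_ae (.of_forall fun x => real_inner_comm (v x) (u x))

theorem fieldPairing_rotPair_grad (ha : 0 < a) (P : Poly)
    {φ : Lp ℝ q' (area a) × Lp E3 q' (area a)} (hφ : φ ∈ H1Scalar a q') :
    fieldPairing a q q' (rotPair a q P).1 φ.2 = 0 := by
  let Λ : Lp ℝ q' (area a) × Lp E3 q' (area a) →L[ℝ] ℝ :=
    fieldPairing a q q' (rotPair a q P).1 ∘L ContinuousLinearMap.snd ℝ _ _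
  have hle : H1Scalar a q' ≤ Λ.ker := by
    refine Submodule.topologicalClosure_minimal _ (fun r ⟨Φ, hΦ, _, hr⟩ => ?_) Λ.isClosed_ker
    refine (lpPairing_innerSL_congr (coeFn_rotPair_fst a q P) hr).trans ?_
    simpa only [inner_surfaceGrad a Φ (inner_rotField_self P _)] using
      integral_fderiv_rotField ha P (hΦ.of_le (by simp))
  exact hle hφ

theorem rotPair_mem_helmholtzGraph (ha : 0 < a) (P : Poly) :
    ((rotPair a q P).1, (rotPair a q P).1) ∈ helmholtzGraph a q q' := by
  refine ⟨?_, 0, zero_mem _, (sub_zero _).symm, fun φ hφ => ?_⟩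
  · filter_upwards [coeFn_rotPair_fst a q P] with x hx
    rw [hx, inner_rotField_self]
  · rw [fieldPairing_rotPair_grad ha P hφ, Prod.snd_zero, map_zero, zero_apply]

theorem scalarPair_mem_helmholtzGraph (ha : 0 < a) (P : Poly) :
    ((scalarPair a q P).2, 0) ∈ helmholtzGraph a q q' := by
  refine ⟨?_, scalarPair a q P, scalarPair_mem_H1Scalar P, (sub_self _).symm, fun _ _ => rfl⟩
  filter_upwards [coeFn_scalarPair_snd a q P, ae_mem_sphere_of_pos ha] with x hx hxa
  rw [hx, surfaceGrad, inner_tangentProj ha.ne' hxa]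

theorem rotPair_mem_H1Sol (ha : 0 < a) (P : Poly) : rotPair a q P ∈ H1Sol a q q' :=
  ⟨rotPair_mem_H1 P, _, rotPair_mem_helmholtzGraph ha P, rfl⟩

theorem fieldPairing_grad_of_mem_LqSol {u : Lp E3 q (area a)} (hu : u ∈ LqSol a q q')
    {φ : Lp ℝ q' (area a) × Lp E3 q' (area a)} (hφ : φ ∈ H1Scalar a q') :
    fieldPairing a q q' u φ.2 = 0 := by
  obtain ⟨⟨f, w⟩, ⟨-, ψ, -, hw, hψ⟩, rfl⟩ := hu
  rw [LinearMap.snd_apply, hw, map_sub, sub_apply, hψ φ hφ, sub_self]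

theorem fieldPairing_of_mem_helmholtzGraph {f w : Lp E3 q (area a)}
    (h : (f, w) ∈ helmholtzGraph a q q') {v : Lp E3 q' (area a)} (hv : v ∈ LqSol a q' q) :
    fieldPairing a q q' w v = fieldPairing a q q' f v := by
  obtain ⟨-, ψ, hψ, hw, -⟩ := h
  dsimp only at hw
  rw [hw, map_sub, sub_apply, fieldPairing_comm ψ.2, fieldPairing_grad_of_mem_LqSol hv hψ, sub_zero]

theorem fieldPairing_helmholtzProj {f : Lp E3 q (area a)}
    (hf : ∃ w, (f, w) ∈ helmholtzGraph a q q') {v : Lp E3 q' (area a)} (hv : v ∈ LqSol a q' q) :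
    fieldPairing a q q' (helmholtzProj a q q' f) v = fieldPairing a q q' f v := by
  rw [helmholtzProj, dif_pos hf, fieldPairing_of_mem_helmholtzGraph hf.choose_spec hv]

theorem isSolenoidal_of_mem_H1Sol (ha : 0 < a) {p : Lp E3 q (area a) × Lp T3 q (area a)}
    (hp : p ∈ H1Sol a q q') : IsSolenoidal a p.1 where
  integrable := integrable_coeFn p.1
  tangent := ae_tangent_of_mem_H1 ha hp.1
  divFree P := by
    have hgrad : fieldPairing a q q' p.1 (scalarPair a q' P).2 = 0 :=
      fieldPairing_grad_of_mem_LqSol hp.2 (scalarPair_mem_H1Scalar P)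
    rw [← hgrad, fieldPairing, lpPairing_innerSL_congr .rfl (coeFn_scalarPair_snd a q' P)]
    refine integral_congr_ae ?_
    filter_upwards [ae_tangent_of_mem_H1 ha hp.1] with x hx
    rw [inner_surfaceGrad a _ hx, inner_polyField_polyGrad]

end HelmholtzDecomposition

section Coriolis

theorem inner_cross_left (x v w : E3) : ⟪cross x v, w⟫ = -⟪v, cross x w⟫ := by
  simp only [inner_eq_sum, cross, cross_apply, Fin.sum_univ_three, Matrix.cons_val]
  ring

theorem cross_cross_self (x v : E3) : cross x (cross x v) = ⟪x, v⟫ • x - ⟪x, x⟫ • v := by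
  refine PiLp.ext fun i => ?_
  simp only [cross, cross_apply, inner_eq_sum, Fin.sum_univ_three, Matrix.cons_val,
    PiLp.sub_apply, PiLp.smul_apply, smul_eq_mul]
  fin_cases i <;> simp <;> ring

theorem rotField_eq_cross (P : Poly) (x : E3) :
    rotField P x = cross x (polyField (polyGrad P) x) := by
  refine PiLp.ext fun i => ?_
  fin_cases i <;>
    simp [rotField_apply, cross, cross_apply, polyField, polyGrad_apply, rotDeriv_zero,
      rotDeriv_one, rotDeriv_two]

theorem inner_coriolisAt_left (a ω : ℝ) (x v w : E3) :
    ⟪coriolisAt a ω x v, w⟫ = -⟪v, coriolisAt a ω x w⟫ := by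
  rw [coriolisAt, coriolisAt, real_inner_smul_left, real_inner_smul_right, rotK, inner_cross_left,
    mul_neg, rotK]

theorem rotK_cross {a : ℝ} (ha : a ≠ 0) {x : E3} (hx : x ∈ sphere (0 : E3) a) (v : E3) :
    rotK a x (cross x v) = -a • tangentProj a x v := by
  have hcross : rotK a x (cross x v) = a⁻¹ • cross x (cross x v) :=
    PiLp.ext fun i => by simp [rotK, cross]
  rw [hcross, cross_cross_self, real_inner_self_eq_norm_sq, mem_sphere_zero_iff_norm.1 hx,
    tangentProj_apply]
  match_scalars <;> field_simp

theorem coriolisAt_rotField {a : ℝ} (ha : a ≠ 0) (ω : ℝ) {x : E3} (hx : x ∈ sphere (0 : E3) a)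
    (P : Poly) :
    coriolisAt a ω x (rotField P x) = (2 * ω * x 2) • surfaceGrad a (fun y => ev y P) x := by
  rw [coriolisAt, rotField_eq_cross, rotK_cross ha hx, ← surfaceGrad_ev, smul_smul]
  congr 1
  field_simp

theorem X_two_smul_polyGrad (P : Poly) :
    (X 2 : Poly) • polyGrad P = polyGrad (X 2 * P) - Pi.single 2 P := by
  funext k
  simp [polyGrad_apply, Derivation.leibniz, MvPolynomial.pderiv_X, Pi.single_apply, eq_comm]

theorem coeFn_coriolis {a : ℝ} {q : ℝ≥0∞} (ω : ℝ) (u : Lp E3 q (area a)) :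
    coriolis a ω q u =ᵐ[area a] fun x => coriolisAt a ω x (u x) :=
  MemLp.coeFn_toLp _

theorem fieldPairing_coriolis_rotPair {a : ℝ} {q q' : ℝ≥0∞} [Fact (1 ≤ q)] [Fact (1 ≤ q')]
    [q.HolderConjugate q'] (ha : 0 < a) (ω : ℝ) {u : Lp E3 q (area a)} (hu : IsSolenoidal a u)
    (P : Poly) :
    fieldPairing a q q' (coriolis a ω q u) (rotPair a q' P).1 =
      2 * ω * fieldFunctional hu.integrable (Pi.single 2 P) := by
  have hP : fieldFunctional hu.integrable (Pi.single 2 P) =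
      -fieldFunctional hu.integrable ((X 2 : Poly) • polyGrad P) := by
    rw [X_two_smul_polyGrad, map_sub, fieldFunctional_apply _ (polyGrad _), hu.divFree, zero_sub,
      neg_neg]
  rw [hP, fieldPairing, lpPairing_innerSL_congr (coeFn_coriolis ω u) (coeFn_rotPair_fst a q' P),
    fieldFunctional_apply, mul_neg, ← neg_mul, ← integral_const_mul]
  refine integral_congr_ae ?_
  filter_upwards [ae_mem_sphere_of_pos ha, hu.tangent] with x hx hux
  rw [inner_coriolisAt_left, coriolisAt_rotField ha.ne' ω hx, real_inner_smul_right,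
    inner_surfaceGrad a _ hux, polyField_smul, real_inner_smul_right, inner_polyField_polyGrad,
    ev_X]
  ring

end Coriolis

section KillingFields

theorem exists_eq_sum_smul_X {Q : Poly} (hQ : Q.IsHomogeneous 1) :
    ∃ c : Fin 3 → ℝ, Q = ∑ j, c j • X j := by
  choose c hc using fun j => exists_eq_C_of_isHomogeneous_zero (hQ.pderiv (i := j))
  refine ⟨c, ?_⟩
  rw [← one_smul ℕ Q, ← hQ.sum_X_mul_pderiv]
  exact Finset.sum_congr rfl fun j _ => by rw [hc, mul_comm, MvPolynomial.smul_eq_C_mul]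

theorem rotDeformation_eq_zero (a : ℝ) {Q : Poly} (hQ : Q.IsHomogeneous 1) :
    rotDeformation a Q = 0 := by
  have heuler : Q - euler Q = 0 := by rw [euler_of_isHomogeneous hQ, one_smul, sub_self]
  obtain ⟨c, hc⟩ := exists_eq_sum_smul_X hQ
  funext k l
  rw [rotDeformation, heuler, map_zero, map_zero, hc]
  fin_cases k <;> fin_cases l <;>
    simp [rotDeriv_zero, rotDeriv_one, rotDeriv_two, Fin.sum_univ_three, MvPolynomial.pderiv_X]

theorem two_smul_X_two_smul_polyGrad {Q : Poly} (hQ : Q.IsHomogeneous 1) :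
    (2 : ℝ) • (X 2 : Poly) • polyGrad Q = polyGrad (X 2 * Q) + polyRot (rotDeriv 2 Q) := by
  obtain ⟨c, rfl⟩ := exists_eq_sum_smul_X hQ
  rw [two_smul]
  funext k
  simp only [Pi.add_apply, Pi.smul_apply, polyGrad_apply, polyRot_apply]
  fin_cases k <;>
    simp [rotDeriv_zero, rotDeriv_one, rotDeriv_two, Fin.sum_univ_three, MvPolynomial.pderiv_X,
      Derivation.leibniz, MvPolynomial.smul_eq_C_mul]
  ring

theorem exists_eq_smul_X_two {Q : Poly} (hQ : Q.IsHomogeneous 1) (h : rotDeriv 2 Q = 0) :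
    ∃ κ : ℝ, Q = κ • X 2 := by
  obtain ⟨c, rfl⟩ := exists_eq_sum_smul_X hQ
  have h0 : c 0 = 0 := by
    simpa [rotDeriv_two, Fin.sum_univ_three, MvPolynomial.pderiv_X, MvPolynomial.smul_eq_C_mul]
      using congrArg (pderiv 1) h
  have h1 : c 1 = 0 := by
    simpa [rotDeriv_two, Fin.sum_univ_three, MvPolynomial.pderiv_X, MvPolynomial.smul_eq_C_mul]
      using congrArg (pderiv 0) h
  exact ⟨c 2, by rw [Fin.sum_univ_three, h0, h1, zero_smul, zero_smul, zero_add, zero_add]⟩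

theorem coriolisAt_rotField_of_isHomogeneous_one {a : ℝ} (ha : a ≠ 0) (ω : ℝ) {x : E3}
    (hx : x ∈ sphere (0 : E3) a) {Q : Poly} (hQ : Q.IsHomogeneous 1) :
    coriolisAt a ω x (rotField Q x) =
      ω • (surfaceGrad a (fun y => ev y (X 2 * Q)) x + rotField (rotDeriv 2 Q) x) := by
  have hgrad : (2 * x 2) • polyField (polyGrad Q) x =
      polyField (polyGrad (X 2 * Q)) x + rotField (rotDeriv 2 Q) x := by
    rw [mul_smul, ← ev_X x 2, ← polyField_smul, ← polyField_real_smul,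
      two_smul_X_two_smul_polyGrad hQ, polyField_add]
    rfl
  rw [coriolisAt_rotField ha ω hx, surfaceGrad_ev, mul_comm 2 ω, mul_assoc, mul_smul, ← map_smul,
    hgrad, map_add, tangentProj_of_inner_eq_zero (inner_rotField_self _ x), surfaceGrad_ev]

variable {a : ℝ} {q : ℝ≥0∞} {Q : Poly}

theorem coriolis_eq_smul_add (ha : 0 < a) (ω : ℝ) (hQ : Q.IsHomogeneous 1)
    {u : Lp E3 q (area a)} (hu : u =ᵐ[area a] rotField Q) :
    coriolis a ω q u =
      ω • ((scalarPair a q (X 2 * Q)).2 + (rotPair a q (rotDeriv 2 Q)).1) := by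
  refine Lp.ext ?_
  filter_upwards [coeFn_coriolis ω u, hu, ae_mem_sphere_of_pos ha, Lp.coeFn_smul ω
      ((scalarPair a q (X 2 * Q)).2 + (rotPair a q (rotDeriv 2 Q)).1),
    Lp.coeFn_add (scalarPair a q (X 2 * Q)).2 (rotPair a q (rotDeriv 2 Q)).1,
    coeFn_scalarPair_snd a q (X 2 * Q), coeFn_rotPair_fst a q (rotDeriv 2 Q)]
    with x hcor hux hx hsmul hadd hgrad hrot
  rw [hcor, hux, coriolisAt_rotField_of_isHomogeneous_one ha.ne' ω hx hQ, hsmul, Pi.smul_apply,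
    hadd, Pi.add_apply, hgrad, hrot]

theorem rotPair_smul (c : ℝ) (P : Poly) : rotPair a q (c • P) = c • rotPair a q P := by
  have hrot : rotField (c • P) = c • rotField P :=
    funext fun x => PiLp.ext fun k => by simp [rotField_apply]
  refine Prod.ext (Lp.ext ?_) (Lp.ext ?_)
  · filter_upwards [coeFn_rotPair_fst a q (c • P), coeFn_rotPair_fst a q P,
      Lp.coeFn_smul c (rotPair a q P).1] with x hcP hP hsmul
    rw [hcP, Prod.smul_fst, hsmul, Pi.smul_apply, hP, hrot, Pi.smul_apply]
  · filter_upwards [coeFn_rotPair_snd a q (c • P), coeFn_rotPair_snd a q P,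
      Lp.coeFn_smul c (rotPair a q P).2] with x hcP hP hsmul
    rw [hcP, Prod.smul_snd, hsmul, Pi.smul_apply, hP, hrot,
      covDeriv_smul a c (isSmoothField_rotField a P).smooth]

theorem rotPair_zero : rotPair a q 0 = 0 := by
  rw [← zero_smul ℝ (0 : Poly), rotPair_smul, zero_smul]

theorem compLpL_symPart_rotPair (hQ : Q.IsHomogeneous 1) [Fact (1 ≤ q)] :
    symPart.compLpL q (area a) (rotPair a q Q).2 = 0 := by
  refine Lp.ext ?_
  filter_upwards [symPart.coeFn_compLpL (rotPair a q Q).2, coeFn_rotPair_snd a q Q,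
    Lp.coeFn_zero T3 q (area a)] with x hD hQx hzero
  rw [hD, hQx, symPart_covDeriv_rotField, rotDeformation_eq_zero a hQ, hzero]
  exact PiLp.ext fun _ => by simp [polyTensor]

theorem dThetaPair_eq_rotPair : dThetaPair a q = rotPair a q ((-1 : ℝ) • X 2) := by
  have h : dTheta = rotField ((-1 : ℝ) • X 2) := by
    refine funext fun x => PiLp.ext fun i => ?_
    fin_cases i <;> simp [dTheta, rotField_apply, rotDeriv_zero, rotDeriv_one, rotDeriv_two,
      MvPolynomial.pderiv_X]
  simp only [dThetaPair, h]
  rfl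

theorem mem_equilibria_iff {p : Lp E3 q (area a) × Lp T3 q (area a)} :
    p ∈ equilibria a q ↔
      ∃ Q : Poly, Q.IsHomogeneous 1 ∧ rotDeriv 2 Q = 0 ∧ p = rotPair a q Q := by
  constructor
  · rintro ⟨c, rfl⟩
    refine ⟨c • (-1 : ℝ) • X 2, ?_, ?_, by rw [dThetaPair_eq_rotPair, rotPair_smul c]⟩
    · rw [smul_smul]
      exact (MvPolynomial.homogeneousSubmodule (Fin 3) ℝ 1).smul_mem _
        (MvPolynomial.isHomogeneous_X ℝ 2)
    · simp [rotDeriv_two, MvPolynomial.pderiv_X]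
  · rintro ⟨Q, hQ, h, rfl⟩
    obtain ⟨κ, rfl⟩ := exists_eq_smul_X_two hQ h
    refine ⟨-κ, ?_⟩
    rw [dThetaPair_eq_rotPair, ← rotPair_smul, smul_smul, neg_mul_neg, mul_one]

end KillingFields

section Kernel

variable {a : ℝ} {q q' : ℝ≥0∞} [Fact (1 ≤ q)] [Fact (1 ≤ q')] [q.HolderConjugate q']

theorem coriolis_mem_helmholtzGraph (ha : 0 < a) (ω : ℝ) {Q : Poly} (hQ : Q.IsHomogeneous 1)
    {u : Lp E3 q (area a)} (hu : u =ᵐ[area a] rotField Q) :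
    (coriolis a ω q u, ω • (rotPair a q (rotDeriv 2 Q)).1) ∈ helmholtzGraph a q q' := by
  rw [coriolis_eq_smul_add ha ω hQ hu]
  simpa using (helmholtzGraph a q q').smul_mem ω (add_mem
    (scalarPair_mem_helmholtzGraph ha (X 2 * Q)) (rotPair_mem_helmholtzGraph ha (rotDeriv 2 Q)))

theorem weakStokes_apply (μs : ℝ) (u : H1Sol a q q') (v : H1Sol a q' q) :
    weakStokes a μs q q' u v = 2 * μs * tensorPairing a q q'
      (symPart.compLpL q (area a) u.1.2) (symPart.compLpL q' (area a) v.1.2) := rfl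

theorem weakCoriolis_apply (ω : ℝ) (u : H1Sol a q q') (v : H1Sol a q' q) :
    weakCoriolis a ω q q' u v =
      fieldPairing a q q' (helmholtzProj a q q' (coriolis a ω q u.1.1)) v.1.1 := rfl

theorem rotPair_mem_weakKernel (ha : 0 < a) (μs ω : ℝ) {Q : Poly} (hQ : Q.IsHomogeneous 1)
    (h : rotDeriv 2 Q = 0) : rotPair a q Q ∈ weakKernel a μs ω q q' := by
  refine ⟨⟨rotPair a q Q, rotPair_mem_H1Sol ha Q⟩, ContinuousLinearMap.ext fun v => ?_, rfl⟩
  have hC : (coriolis a ω q (rotPair a q Q).1, 0) ∈ helmholtzGraph a q q' := by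
    simpa [h, rotPair_zero] using coriolis_mem_helmholtzGraph ha ω hQ (coeFn_rotPair_fst a q Q)
  have hv : v.1.1 ∈ LqSol a q' q := v.2.2
  rw [add_apply, weakStokes_apply, weakCoriolis_apply, compLpL_symPart_rotPair hQ,
    fieldPairing_helmholtzProj ⟨0, hC⟩ hv, ← fieldPairing_of_mem_helmholtzGraph hC hv]
  simp

variable {μs ω : ℝ} {u : H1Sol a q q'}

theorem fieldFunctional_of_kernel (ha : 0 < a)
    (h : weakStokes a μs q q' u + weakCoriolis a ω q q' u = 0) (P : Poly) :
    fieldPairing a q q' (helmholtzProj a q q' (coriolis a ω q u.1.1)) (rotPair a q' P).1 =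
      μs * (a ^ 2)⁻¹ * fieldFunctional (integrable_coeFn u.1.1)
        (polyRot (sphLaplacian P + (2 : ℝ) • P)) := by
  have hP := congrArg (fun T : HNeg1Sol a q q' => T ⟨rotPair a q' P, rotPair_mem_H1Sol ha P⟩) h
  simp only [add_apply, weakStokes_apply, weakCoriolis_apply, zero_apply,
    tensorPairing_symPart_rotPair ha u.2.1, mul_inv] at hP
  linear_combination hP

theorem exists_helmholtzGraph_of_kernel (ha : 0 < a) (hμs : μs ≠ 0)
    (h : weakStokes a μs q q' u + weakCoriolis a ω q q' u = 0) :
    ∃ w, (coriolis a ω q u.1.1, w) ∈ helmholtzGraph a q q' := by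
  by_contra hex
  have hproj : helmholtzProj a q q' (coriolis a ω q u.1.1) = 0 := dif_neg hex
  have hsol := isSolenoidal_of_mem_H1Sol ha u.2
  have hstokes (P : Poly) : fieldFunctional hsol.integrable (polyRot
      (sphLaplacian (sphLaplacian P) + (2 : ℝ) • sphLaplacian P + (0 : ℝ) • rotDeriv 2 P)) = 0 := by
    have hP := fieldFunctional_of_kernel ha h (sphLaplacian P)
    rw [hproj, map_zero, zero_apply] at hP
    rw [zero_smul, add_zero]
    exact (mul_eq_zero.1 hP.symm).resolve_left (by positivity)
  obtain ⟨Q, hQ, -, huQ⟩ := hsol.exists_ae_eq_rotField ha hstokes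
  exact hex ⟨_, coriolis_mem_helmholtzGraph ha ω hQ huQ⟩

theorem fieldFunctional_stokes_add_coriolis_of_kernel (ha : 0 < a) (hμs : μs ≠ 0)
    (h : weakStokes a μs q q' u + weakCoriolis a ω q q' u = 0) (P : Poly) :
    fieldFunctional (integrable_coeFn u.1.1) (polyRot (sphLaplacian (sphLaplacian P) +
      (2 : ℝ) • sphLaplacian P + (-(2 * ω * a ^ 2 / μs)) • rotDeriv 2 P)) = 0 := by
  have hsol := isSolenoidal_of_mem_H1Sol ha u.2
  have hv : (rotPair a q' (sphLaplacian P)).1 ∈ LqSol a q' q :=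
    (rotPair_mem_H1Sol ha (sphLaplacian P)).2
  have hP := fieldFunctional_of_kernel ha h (sphLaplacian P)
  rw [fieldPairing_helmholtzProj (exists_helmholtzGraph_of_kernel ha hμs h) hv,
    fieldPairing_coriolis_rotPair ha ω hsol, hsol.fieldFunctional_single_sphLaplacian] at hP
  rw [map_add polyRot, map_add, map_smul polyRot (-_), map_smul _ (-_), smul_eq_mul]
  field_simp at hP ⊢
  linear_combination -hP

theorem mem_weakKernel_iff (ha : 0 < a) (hμs : μs ≠ 0) (hω : ω ≠ 0)
    {p : Lp E3 q (area a) × Lp T3 q (area a)} :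
    p ∈ weakKernel a μs ω q q' ↔
      ∃ Q : Poly, Q.IsHomogeneous 1 ∧ rotDeriv 2 Q = 0 ∧ p = rotPair a q Q := by
  constructor
  · rintro ⟨u, h, rfl⟩
    obtain ⟨Q, hQ, hrot, huQ⟩ := (isSolenoidal_of_mem_H1Sol ha u.2).exists_ae_eq_rotField ha
      (fieldFunctional_stokes_add_coriolis_of_kernel ha hμs h)
    exact ⟨Q, hQ, (smul_eq_zero.1 hrot).resolve_left (by simp [ha.ne', hμs, hω]),
      eq_rotPair_of_ae_eq ha u.2.1 huQ⟩
  · rintro ⟨Q, hQ, h, rfl⟩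
    exact rotPair_mem_weakKernel ha μs ω hQ h

end Kernel

end SphereFlow

end

theorem lemma3p1_general (a μs ω : ℝ) (ha : 0 < a) (hμs : μs ≠ 0) (hω : ω ≠ 0)
    (q q' : ℝ≥0∞) [Fact (1 ≤ q)] [Fact (1 ≤ q')] [q.HolderConjugate q'] :
    SphereFlow.weakKernel a μs ω q q' = SphereFlow.equilibria a q :=
  Set.ext fun _ =>
    (SphereFlow.mem_weakKernel_iff ha hμs hω).trans SphereFlow.mem_equilibria_iff.symm

theorem lemma3p1 (a μs ω : ℝ) (ha : 0 < a) (hμs : 0 < μs) (hω : ω ≠ 0)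
    (q q' : ℝ≥0∞) (hq : 1 < q) (hq_top : q < ⊤) [Fact (1 ≤ q)] [Fact (1 ≤ q')]
    [q.HolderConjugate q'] :
    SphereFlow.weakKernel a μs ω q q' = SphereFlow.equilibria a q := by
  exact lemma3p1_general a μs ω ha hμs.ne' hω q q'
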